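/- Let $A=\begin{bmatrix} a&b\\ c&d\end{bmatrix}\in \mathrm{SL}(2,\mathbb Z)$ with $|a+d|>2$ and $ab$, $cd$ even, and let $\lambda$ denote the eigenvalue of $A$ of absolute value greater than $1$. For $N\in\mathbb N$ put $h=(2\pi N)^{-1}$, let $U_{(y,\eta)}f(x)=e^{\frac ih\eta x-\frac i{2h}y\eta}f(x-y)$ be the quantum translations, acting on tempered distributions, and let $$\mathcal H_N(0)=\{f\in\mathscr S'(\mathbb R): U_{(y,\eta)}f=e^{\pi i N y\eta}f\ \text{ for all } (y,\eta)\in\mathbb Z^2\},$$ an $N$-dimensional space with basis $e_j=\frac1{\sqrt N}\sum_{k\in\mathbb Z}\delta\big(x-\tfrac{Nk+j}{N}\big)$, $0\le j\le N-1$. For $u=\sum_j u_je_j\in\mathcal H_N(0)$ let $\|u\|_{\ell^2}=(\sum_j|u_j|^2)^{1/2}$ and $\|u\|_{\ell^\infty}=\max_j|u_j|$. Let $M$ be a metaplectic operator associated with $A$: a unitary operator on $L^2(\mathbb R)$ with $M^{-1}\mathrm{Op}_h(f)M=\mathrm{Op}_h(f\circ A)$ for every smooth $f:\mathbb R^2\to\mathbb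 C$ all of whose derivatives are bounded, where $\mathrm{Op}_h$ is the Weyl quantization. It is unique up to a factor of modulus one, extends continuously to $\mathscr S'(\mathbb R)$, and restricts to a map $M_{N,0}:\mathcal H_N(0)\to\mathcal H_N(0)$, the quantum cat map. Then for every $0<\varepsilon<1$ there exists $N_0$ (depending only on $A$ and $\varepsilon$) such that for all odd $N\ge N_0$, every eigenfunction $u$ of $M_{N,0}$ with $\|u\|_{\ell^2}=1$ satisfies $$\|u\|_{\ell^\infty}\le \frac{1}{\sqrt{(1-\varepsilon)\log_{|\lambda|}N}}.$$ -/

import Mathlib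

namespace QuantumCat

noncomputable section

open MeasureTheory SchwartzMap
open scoped ENNReal ContDiff

/-! ### Weyl quantization and metaplectic operators -/

/-- The Hilbert space `L²(ℝ)`. -/
abbrev L2 : Type := Lp ℂ 2 (volume : Measure ℝ)

/-- The symbol class `S(1)`: smooth functions on `ℝ²` all of whose derivatives are bounded. -/
def IsSymbol (a : ℝ × ℝ → ℂ) : Prop :=
  ContDiff ℝ ∞ a ∧ ∀ n : ℕ, ∃ C : ℝ, ∀ z, ‖iteratedFDeriv ℝ n a z‖ ≤ C

/-- The semiclassical Weyl quantization `Op_h(a) f` of a Schwartz function `f`. For `a ∈ S(1)` the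
inner integral decays faster than any power of `ξ`, so that both integrals converge. -/
def weylOp (h : ℝ) (a : ℝ × ℝ → ℂ) (f : 𝓢(ℝ, ℂ)) (x : ℝ) : ℂ :=
  (1 / (2 * Real.pi * h) : ℝ) *
    ∫ ξ : ℝ, ∫ x' : ℝ,
      Complex.exp (Complex.I / h * ((x - x') * ξ)) * a ((x + x') / 2, ξ) * f x'

/-- The bounded operator `T` on `L²(ℝ)` is the Weyl quantization `Op_h(a)`, that is, it is the
(unique) bounded operator on `L²(ℝ)` which agrees with `Op_h(a)` on Schwartz functions. -/
def IsWeylQuantization (h : ℝ) (a : ℝ × ℝ → ℂ) (T : L2 →L[ℂ] L2) : Prop :=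
  ∀ f : 𝓢(ℝ, ℂ), (T (f.toLp 2 volume) : ℝ → ℂ) =ᵐ[volume] weylOp h a f

/-- The linear action of a matrix on phase space `ℝ²`, with points `z = (x, ξ)`. -/
def phaseMap (A : Matrix.SpecialLinearGroup (Fin 2) ℝ) (z : ℝ × ℝ) : ℝ × ℝ :=
  (A 0 0 * z.1 + A 0 1 * z.2, A 1 0 * z.1 + A 1 1 * z.2)

/-- `M` belongs to the set `𝓜_A` of metaplectic operators over `A ∈ SL(2, ℝ)`: it is a unitary
operator on `L²(ℝ)` with `M⁻¹ Op_h(a) M = Op_h(a ∘ A)` for every symbol `a ∈ S(1)`. -/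
def IsMetaplectic (h : ℝ) (A : Matrix.SpecialLinearGroup (Fin 2) ℝ) (M : L2 ≃ₗᵢ[ℂ] L2) : Prop :=
  ∀ a : ℝ × ℝ → ℂ, IsSymbol a → ∀ T : L2 →L[ℂ] L2, IsWeylQuantization h a T →
    IsWeylQuantization h (a ∘ phaseMap A)
      ((M.symm : L2 →L[ℂ] L2) ∘L T ∘L (M : L2 →L[ℂ] L2))

/-- `M'` is the extension of the operator `M` on `L²(ℝ)` to tempered distributions: it is
continuous and linear (for the topology of pointwise convergence on `𝓢'(ℝ)`) and agrees with `M`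
on `L²(ℝ) ⊆ 𝓢'(ℝ)`. As `L²(ℝ)` is dense in `𝓢'(ℝ)`, there is at most one such `M'`. -/
def IsDistributionExtension (M : L2 ≃ₗᵢ[ℂ] L2) (M' : 𝓢'(ℝ, ℂ) →L[ℂ] 𝓢'(ℝ, ℂ)) : Prop :=
  ∀ f : L2, M' (Lp.toTemperedDistribution f) = Lp.toTemperedDistribution (M f)

/-! ### Quantum translations and quantum states -/

theorem hasTemperateGrowth_cexp (c d : ℝ) :
    (fun x : ℝ ↦ Complex.exp (Complex.I * (c * x + d : ℝ))).HasTemperateGrowth := by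
  have hd : ∀ x : ℝ, HasDerivAt (fun x : ℝ ↦ Complex.exp (Complex.I * (c * x + d : ℝ)))
      ((Complex.I * c) * Complex.exp (Complex.I * (c * x + d : ℝ))) x := by
    intro x
    have h1 : HasDerivAt (fun x : ℝ ↦ c * x + d) c x := by
      simpa using ((hasDerivAt_id x).const_mul c).add_const d
    have := (h1.ofReal_comp.const_mul Complex.I).cexp
    convert! this using 1
    ring
  have hn : ∀ n : ℕ, iteratedDeriv n (fun x : ℝ ↦ Complex.exp (Complex.I * (c * x + d : ℝ))) =
      fun x : ℝ ↦ (Complex.I * c) ^ n * Complex.exp (Complex.I * (c * x + d : ℝ)) := by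
    intro n
    induction n with
    | zero => simp
    | succ n ih =>
      rw [iteratedDeriv_succ, ih]
      funext x
      rw [((hd x).const_mul _).deriv]
      ring
  refine ⟨?_, fun n ↦ ⟨0, |c| ^ n, fun x ↦ ?_⟩⟩
  · have h1 : ContDiff ℝ ∞ (fun x : ℝ ↦ c * x + d) :=
      (contDiff_const.mul contDiff_id).add contDiff_const
    have : ContDiff ℝ ∞ (fun x : ℝ ↦ Complex.I * ((c * x + d : ℝ) : ℂ)) :=
      contDiff_const.mul (Complex.ofRealCLM.contDiff.comp h1)
    exact this.cexp
  · rw [norm_iteratedFDeriv_eq_norm_iteratedDeriv, hn]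
    have := Complex.norm_exp_I_mul_ofReal (c * x + d)
    rw [norm_mul, this]
    simp

/-- The quantum translation `U_w`, `w = (y, η)`, on Schwartz functions:
`U_w f(x) = exp((i/h) η x - (i/2h) y η) f(x - y)`. -/
def translationSchwartz (h : ℝ) (w : ℝ × ℝ) : 𝓢(ℝ, ℂ) →L[ℂ] 𝓢(ℝ, ℂ) :=
  SchwartzMap.smulLeftCLM ℂ
    (fun x : ℝ ↦ Complex.exp (Complex.I * (w.2 / h * x + -(w.1 * w.2 / (2 * h)) : ℝ))) ∘L
      SchwartzMap.compSubConstCLM ℂ w.1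

theorem translationSchwartz_apply (h : ℝ) (w : ℝ × ℝ) (f : 𝓢(ℝ, ℂ)) (x : ℝ) :
    translationSchwartz h w f x =
      Complex.exp (Complex.I / h * (w.2 * x) - Complex.I / (2 * h) * (w.1 * w.2)) *
        f (x - w.1) := by
  rw [translationSchwartz, ContinuousLinearMap.comp_apply,
    SchwartzMap.smulLeftCLM_apply_apply (hasTemperateGrowth_cexp _ _)]
  simp only [SchwartzMap.compSubConstCLM_apply, smul_eq_mul]
  congr 2
  push_cast
  ring

/-- The quantum translation `U_w` on tempered distributions, defined by duality; the transpose of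
`U_(y, η)` on Schwartz functions is `U_(-y, η)`. -/
def translation (h : ℝ) (w : ℝ × ℝ) : 𝓢'(ℝ, ℂ) →L[ℂ] 𝓢'(ℝ, ℂ) :=
  PointwiseConvergenceCLM.precomp _ (translationSchwartz h (-w.1, w.2))

theorem translation_apply (h : ℝ) (w : ℝ × ℝ) (u : 𝓢'(ℝ, ℂ)) (φ : 𝓢(ℝ, ℂ)) :
    translation h w u φ = u (translationSchwartz h (-w.1, w.2) φ) := rfl

/-- The two definitions of `U_w` agree on Schwartz functions. -/
theorem translation_coe (h : ℝ) (w : ℝ × ℝ) (f : 𝓢(ℝ, ℂ)) :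
    translation h w (f : 𝓢'(ℝ, ℂ)) = (translationSchwartz h w f : 𝓢(ℝ, ℂ)) := by
  ext φ
  rw [translation_apply]
  simp only [SchwartzMap.coe_apply, translationSchwartz_apply, smul_eq_mul]
  rw [← integral_sub_right_eq_self _ w.1]
  refine integral_congr_ae (Filter.Eventually.of_forall fun x ↦ ?_)
  simp only [sub_neg_eq_add, sub_add_cancel]
  rw [show ∀ a b c d : ℂ, a * b * c = b * (a * c) from fun a b c d ↦ by ring]
  · congr 3
    push_cast
    ring
  · exact 0

/-- The standard symplectic form `σ(z, w) = ξ y - x η`, `z = (x, ξ)`, `w = (y, η)`. -/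
def symp (z w : ℝ × ℝ) : ℝ := z.2 * w.1 - z.1 * w.2

/-- The semiclassical parameter `h = (2πN)⁻¹`. -/
def planck (N : ℕ) : ℝ := (2 * Real.pi * N)⁻¹

/-- The space `𝓗_N(θ)` of quantum states: tempered distributions `f` with
`U_w f = exp(2πi σ(θ, w) + N π i Q(w)) f` for all `w = (y, η) ∈ ℤ²`, where `Q(w) = y η`. -/
def quantumStates (N : ℕ) (θ : ℝ × ℝ) : Submodule ℂ 𝓢'(ℝ, ℂ) where
  carrier := {f | ∀ y η : ℤ, translation (planck N) ((y : ℝ), (η : ℝ)) f =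
    Complex.exp (2 * Real.pi * Complex.I * symp θ ((y : ℝ), (η : ℝ)) +
      N * Real.pi * Complex.I * (y * η)) • f}
  add_mem' := fun hf hg y η ↦ by rw [map_add, hf y η, hg y η, smul_add]
  zero_mem' := fun y η ↦ by rw [map_zero, smul_zero]
  smul_mem' := fun c f hf y η ↦ by rw [map_smul, hf y η, smul_comm]

/-! ### The standard basis of `𝓗_N(0)` and the norms -/

theorem summable_aux : Summable fun k : ℤ ↦ ((1 + |(k : ℝ)|) ^ 2)⁻¹ := by
  have h : Summable fun n : ℕ ↦ ((1 + (n : ℝ)) ^ 2)⁻¹ := by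
    have := (summable_nat_add_iff 1).2 (Real.summable_nat_pow_inv.2 (show 1 < 2 by norm_num))
    refine this.congr fun n ↦ ?_
    push_cast
    rw [add_comm]
  refine Summable.of_nat_of_neg ?_ ?_ <;> simpa using h

theorem comb_bound (t : ℝ) (φ : 𝓢(ℝ, ℂ)) (k : ℤ) :
    ‖φ (t + k)‖ ≤ (4 * (1 + |t|) ^ 2 *
      (Finset.Iic (2, 0)).sup (schwartzSeminormFamily ℂ ℝ ℂ) φ) * ((1 + |(k : ℝ)|) ^ 2)⁻¹ := by
  have h1 := SchwartzMap.one_add_le_sup_seminorm_apply (𝕜 := ℂ) (m := (2, 0)) (k := 2) (n := 0)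
    le_rfl le_rfl φ (t + k)
  simp only [norm_iteratedFDeriv_zero, Real.norm_eq_abs] at h1
  have h2 : 1 + |(k : ℝ)| ≤ (1 + |t|) * (1 + |t + k|) := by
    have : |(k : ℝ)| ≤ |t + k| + |t| := by
      have := abs_sub (t + k) t
      simpa using this
    nlinarith [abs_nonneg t, abs_nonneg (t + k), mul_nonneg (abs_nonneg t) (abs_nonneg (t + k))]
  have h3 : (1 + |(k : ℝ)|) ^ 2 ≤ (1 + |t|) ^ 2 * (1 + |t + k|) ^ 2 := by
    rw [← mul_pow]
    gcongr
  rw [← div_eq_mul_inv, le_div_iff₀ (by positivity)]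
  calc ‖φ (t + k)‖ * (1 + |(k : ℝ)|) ^ 2
      ≤ ‖φ (t + k)‖ * ((1 + |t|) ^ 2 * (1 + |t + k|) ^ 2) := by gcongr
    _ = (1 + |t|) ^ 2 * ((1 + |t + k|) ^ 2 * ‖φ (t + k)‖) := by ring
    _ ≤ (1 + |t|) ^ 2 * (2 ^ 2 * (Finset.Iic (2, 0)).sup (schwartzSeminormFamily ℂ ℝ ℂ) φ) := by
        exact mul_le_mul_of_nonneg_left h1 (by positivity)
    _ = _ := by ring

theorem comb_summable (t : ℝ) (φ : 𝓢(ℝ, ℂ)) : Summable fun k : ℤ ↦ φ (t + k) :=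
  Summable.of_norm_bounded (summable_aux.mul_left _) (comb_bound t φ)

/-- The Dirac comb `∑_{k ∈ ℤ} δ(x - t - k)`. -/
def comb (t : ℝ) : 𝓢'(ℝ, ℂ) :=
  ContinuousLinearMap.toPointwiseConvergenceCLM _ _ _ _ <|
    SchwartzMap.mkCLMtoNormedSpace (𝕜 := ℂ) (σ := RingHom.id ℂ)
      (fun φ : 𝓢(ℝ, ℂ) ↦ ∑' k : ℤ, φ (t + k))
      (fun φ ψ ↦ (comb_summable t φ).tsum_add (comb_summable t ψ))
      (fun c φ ↦ by simpa using (comb_summable t φ).tsum_mul_left c)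
      ⟨Finset.Iic (2, 0), 4 * (1 + |t|) ^ 2 * ∑' k : ℤ, ((1 + |(k : ℝ)|) ^ 2)⁻¹,
        mul_nonneg (by positivity) (tsum_nonneg fun k ↦ by positivity), fun φ ↦ by
          refine (tsum_of_norm_bounded (summable_aux.hasSum.mul_left _) (comb_bound t φ)).trans ?_
          exact le_of_eq (by ring)⟩

theorem comb_apply (t : ℝ) (φ : 𝓢(ℝ, ℂ)) : comb t φ = ∑' k : ℤ, φ (t + k) := rfl

/-- The basis state `e_j⁰ = N^{-1/2} ∑_{k ∈ ℤ} δ(x - (N k + j) / N)` of `𝓗_N(0)`. -/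
def basisState (N : ℕ) (j : Fin N) : 𝓢'(ℝ, ℂ) :=
  ((1 / Real.sqrt N : ℝ) : ℂ) • comb ((j : ℕ) / N)

theorem basisState_apply (N : ℕ) (j : Fin N) (φ : 𝓢(ℝ, ℂ)) :
    basisState N j φ = ((1 / Real.sqrt N : ℝ) : ℂ) * ∑' k : ℤ, φ ((j : ℕ) / N + k) := rfl

/-- The basis states belong to `𝓗_N(0)`. -/
theorem basisState_mem (N : ℕ) (j : Fin N) : basisState N j ∈ quantumStates N 0 := by
  intro y η
  have hN : (N : ℂ) ≠ 0 := by
    have := j.pos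
    exact_mod_cast this.ne'
  have hpi : (Real.pi : ℂ) ≠ 0 := by exact_mod_cast Real.pi_ne_zero
  ext φ
  rw [translation_apply]
  change basisState N j _ = _ * basisState N j φ
  rw [basisState_apply, basisState_apply, mul_left_comm]
  congr 1
  rw [← (Equiv.addRight y).tsum_eq (fun k : ℤ ↦ φ ((j : ℕ) / N + k)), ← tsum_mul_left]
  refine tsum_congr fun k ↦ ?_
  rw [translationSchwartz_apply]
  congr 1
  · rw [Complex.exp_eq_exp_iff_exists_int]
    refine ⟨N * k * η + j * η, ?_⟩
    simp only [symp, planck]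
    push_cast
    simp
    field_simp
    ring
  · simp only [Equiv.coe_addRight]
    congr 1
    push_cast
    ring

/-- The basis states are linearly independent. -/
theorem basisState_linearIndependent (N : ℕ) : LinearIndependent ℂ (basisState N) := by
  rw [Fintype.linearIndependent_iff]
  intro c hc i
  have hN : (0 : ℝ) < N := by exact_mod_cast i.pos
  let b : ContDiffBump ((i : ℕ) / N : ℝ) := ⟨1 / (2 * N), 1 / N, by positivity, by
    rw [div_lt_div_iff₀ (by positivity) hN]
    linarith⟩
  have hb1 : HasCompactSupport (Complex.ofRealCLM ∘ b) := b.hasCompactSupport.comp_left (by simp)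
  have hb2 : ContDiff ℝ ∞ (Complex.ofRealCLM ∘ b) :=
    Complex.ofRealCLM.contDiff.comp b.contDiff
  let φ : 𝓢(ℝ, ℂ) := hb1.toSchwartzMap hb2
  have hφ : ∀ x, φ x = (b x : ℂ) := fun x ↦ rfl
  have key : ∀ (j : Fin N) (k : ℤ), φ ((j : ℕ) / N + k) = if j = i ∧ k = 0 then 1 else 0 := by
    intro j k
    rw [hφ]
    split_ifs with h
    · obtain ⟨rfl, rfl⟩ := h
      rw [b.one_of_mem_closedBall]
      · simp
      · simp [b]
    · rw [b.zero_of_le_dist]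
      · simp
      · have h0 : ((j : ℕ) : ℤ) + N * k - (i : ℕ) ≠ 0 := by
          intro h0
          apply h
          have hj := j.isLt
          have hi := i.isLt
          have hk : k = 0 := by
            rcases lt_trichotomy k 0 with hk | hk | hk
            · nlinarith
            · exact hk
            · nlinarith
          subst hk
          refine ⟨Fin.ext ?_, rfl⟩
          simp at h0
          omega
        have h1 : (1 : ℝ) ≤ |((j : ℕ) : ℝ) + N * k - (i : ℕ)| := by
          have := Int.one_le_abs h0
          exact_mod_cast this
        rw [Real.dist_eq]
        change 1 / (N : ℝ) ≤ _
        rw [show ((j : ℕ) : ℝ) / N + k - (i : ℕ) / N = (((j : ℕ) : ℝ) + N * k - (i : ℕ)) / N by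
          field_simp, abs_div, abs_of_pos hN]
        gcongr
  have hsum : ∀ j : Fin N, basisState N j φ = if j = i then ((1 / Real.sqrt N : ℝ) : ℂ) else 0 := by
    intro j
    rw [basisState_apply]
    simp only [key]
    split_ifs with h
    · simp [h]
    · simp [h]
  have h := congrArg (fun u : 𝓢'(ℝ, ℂ) ↦ u φ) hc
  have h' : ∑ j, c j * basisState N j φ = 0 := by
    have e : (∑ j, c j • basisState N j) φ = ∑ j, c j * basisState N j φ := by
      rw [sum_apply]
      rfl
    rw [← e]
    exact h
  simp only [hsum] at h'
  simpa [hN.ne', hN.le] using h'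

open Classical in
/-- The coordinates of a quantum state `u ∈ 𝓗_N(0)` in the basis `e_0, …, e_{N-1}`. The second
case of the definition never occurs, because the basis states span `𝓗_N(0)`; in any event, a state
with `l2Norm N u ≠ 0` falls under the first. -/
def coords (N : ℕ) (u : quantumStates N 0) : Fin N → ℂ :=
  if h : ∃ c : Fin N → ℂ, (u : 𝓢'(ℝ, ℂ)) = ∑ j, c j • basisState N j then h.choose else 0

/-- The defining property of the coordinates. -/
theorem coords_eq (N : ℕ) (u : quantumStates N 0) (c : Fin N → ℂ)
    (hc : (u : 𝓢'(ℝ, ℂ)) = ∑ j, c j • basisState N j) : coords N u = c := by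
  have h : ∃ c : Fin N → ℂ, (u : 𝓢'(ℝ, ℂ)) = ∑ j, c j • basisState N j := ⟨c, hc⟩
  rw [coords, dif_pos h]
  have h2 := Fintype.linearIndependent_iff.1 (basisState_linearIndependent N)
    (fun j ↦ h.choose j - c j) (by
      simp only [sub_smul, Finset.sum_sub_distrib]
      rw [← h.choose_spec, ← hc, sub_self])
  funext j
  exact sub_eq_zero.1 (h2 j)

/-- The norm `‖u‖_{ℓ²}` on `𝓗_N(0)`, for which the basis `e_0, …, e_{N-1}` is orthonormal. -/
def l2Norm (N : ℕ) (u : quantumStates N 0) : ℝ := Real.sqrt (∑ j, ‖coords N u j‖ ^ 2)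

/-- The norm `‖u‖_{ℓ^∞}`: the maximum of the absolute values of the coordinates of `u`. -/
def lInfNorm (N : ℕ) (u : quantumStates N 0) : ℝ := ⨆ j, ‖coords N u j‖

/-! ### Quantum cat maps -/

/-- `T` is a quantum cat map `M_{N,0} : 𝓗_N(0) → 𝓗_N(0)` of `A ∈ SL(2, ℤ)`: it is the restriction
to `𝓗_N(0)` of (the extension to `𝓢'(ℝ)` of) a metaplectic operator `M ∈ 𝓜_A`, which is determined
by `A` up to a factor of modulus one. -/
def IsQuantumCatMap (N : ℕ) (A : Matrix.SpecialLinearGroup (Fin 2) ℤ)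
    (T : Module.End ℂ (quantumStates N 0)) : Prop :=
  ∃ (M : L2 ≃ₗᵢ[ℂ] L2) (M' : 𝓢'(ℝ, ℂ) →L[ℂ] 𝓢'(ℝ, ℂ)),
    IsMetaplectic (planck N) (Matrix.SpecialLinearGroup.map (Int.castRingHom ℝ) A) M ∧
    IsDistributionExtension M M' ∧
    ∀ u : quantumStates N 0, (T u : 𝓢'(ℝ, ℂ)) = M' u

end

end QuantumCat

namespace QuantumCat

noncomputable section

open MeasureTheory SchwartzMap
open scoped ENNReal ContDiff FourierTransform

/-! ### Plane waves and quantum translations on `L²(ℝ)` -/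

/-! An averaging argument along the orbit of a basis state. Suppose that a unitary matrix `R`
represents the cat map up to a scalar and fixes the coordinate vector `c` of `u`. With `Q = ∑_{t<n}
R^t`, pairing `Q e_i` with `c` gives `n c_i`, so Cauchy–Schwarz bounds `n² |c_i|²` by `‖Q e_i‖²`, a
sum of the entries `⟨R^s e_i, R^t e_i⟩`. If the diagonal entries of `R^k`, `0 < k ≤ n`, are at most
`δ`, then `n |c_i|² ≤ 1 + n δ` (`natCast_mul_norm_sq_le`).

The dispersion estimate behind `δ` is `Intertwines.norm_diag_sq_le`. The projection to `e_i` is an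
average of the translations by `(0, l)/N`. Conjugation by `R^k` turns these into translations by `(b
l, d l)/N`, where `b`, `d` form the right column of `A^k`, and their diagonal entries vanish unless
`N ∣ b l`. This leaves `N |(R^k)_{ii}|² ≤ |b|`, while `|b|` is at most a constant times `|λ|^k`
(`exists_pow_zero_one_bound`). For `n` close to `(1 - ε/2) log_{|λ|} N` this makes `n δ` small.

No formula for the metaplectic operator is needed, only its commutation with translations, obtained
by quantizing plane waves and carried over to distributions (`IsMetaplectic.translation_apply`).
Irreducibility of the Heisenberg matrices shows that the span of the basis states is preserved, and
Schur's lemma that the induced matrix is a multiple of a unitary one. Dividing by the eigenvalue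
gives `R` (`IsQuantumCatMap.exists_intertwines`); the eigenvalue is nonzero because the extended
operator kills no nonzero combination of basis states. -/

/-- The symbol `z ↦ exp((i/h) σ'(w, z))` of the quantum translation `U_w`. -/
def planeWave (h : ℝ) (w : ℝ × ℝ) (z : ℝ × ℝ) : ℂ :=
  Complex.exp (Complex.I * ((w.2 * z.1 - w.1 * z.2) / h : ℝ))

theorem contDiff_cexp_I : ContDiff ℝ ∞ fun t : ℝ ↦ Complex.exp (Complex.I * t) :=
  (contDiff_const.mul Complex.ofRealCLM.contDiff).cexp

theorem norm_iteratedFDeriv_cexp_I (n : ℕ) (t : ℝ) :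
    ‖iteratedFDeriv ℝ n (fun t : ℝ ↦ Complex.exp (Complex.I * t)) t‖ = 1 := by
  have hn : ∀ n : ℕ, iteratedDeriv n (fun t : ℝ ↦ Complex.exp (Complex.I * t)) =
      fun t : ℝ ↦ Complex.I ^ n * Complex.exp (Complex.I * t) := by
    intro n
    induction n with
    | zero => simp
    | succ n ih =>
      rw [iteratedDeriv_succ, ih]
      funext x
      have h1 : HasDerivAt (fun t : ℝ ↦ Complex.exp (Complex.I * t))
          (Complex.exp (Complex.I * x) * (Complex.I * 1)) x :=
        ((hasDerivAt_id x).ofReal_comp.const_mul Complex.I).cexp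
      rw [(h1.const_mul _).deriv]
      ring
  rw [norm_iteratedFDeriv_eq_norm_iteratedDeriv, hn]
  simp [Complex.norm_exp_I_mul_ofReal]

theorem isSymbol_planeWave (h : ℝ) (w : ℝ × ℝ) : IsSymbol (planeWave h w) := by
  let L : ℝ × ℝ →L[ℝ] ℝ :=
    (w.2 / h) • ContinuousLinearMap.fst ℝ ℝ ℝ - (w.1 / h) • ContinuousLinearMap.snd ℝ ℝ ℝ
  have hL : planeWave h w = (fun t : ℝ ↦ Complex.exp (Complex.I * t)) ∘ L := by
    funext z
    simp only [planeWave, Function.comp, L]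
    congr 3
    simp
    ring
  rw [hL]
  -- All derivatives of `exp(it)` have norm one, and each of the `n` slots contributes a factor
  -- `‖L‖`.
  refine ⟨contDiff_cexp_I.comp L.contDiff, fun n ↦ ⟨1 * ∏ _i : Fin n, ‖L‖, fun z ↦ ?_⟩⟩
  rw [L.iteratedFDeriv_comp_right contDiff_cexp_I z (i := n) (by exact_mod_cast le_top)]
  refine (ContinuousMultilinearMap.norm_compContinuousLinearMap_le _ _).trans ?_
  rw [norm_iteratedFDeriv_cexp_I]

/-- Fourier inversion as an iterated integral, in the shape in which it occurs in `weylOp`. -/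
theorem integral_fourier_inversion (g : 𝓢(ℝ, ℂ)) (y : ℝ) :
    ∫ ζ : ℝ, Complex.exp (2 * Real.pi * Complex.I * (y * ζ)) *
      ∫ v : ℝ, Complex.exp (-2 * Real.pi * Complex.I * (v * ζ)) * g v = g y := by
  have h1 : 𝓕⁻ (𝓕 (g : ℝ → ℂ)) = g := g.continuous.fourierInv_fourier_eq g.integrable
    (by simpa [fourier_coe] using (𝓕 g).integrable)
  have h2 := congrFun h1 y
  rw [Real.fourierInv_eq'] at h2
  rw [← h2]
  refine integral_congr_ae (Filter.Eventually.of_forall fun ζ ↦ ?_)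
  simp only [smul_eq_mul]
  congr 1
  · congr 1
    simp
    ring
  · rw [Real.fourier_eq']
    refine integral_congr_ae (Filter.Eventually.of_forall fun v ↦ ?_)
    simp only [smul_eq_mul]
    congr 2
    simp
    ring

/-- The Weyl quantization of a plane wave is a quantum translation. -/
theorem weylOp_planeWave {h : ℝ} (hh : 0 < h) (w : ℝ × ℝ) (f : 𝓢(ℝ, ℂ)) (x : ℝ) :
    weylOp h (planeWave h w) f x = translationSchwartz h w f x := by
  -- At the midpoint `(x + x')/2` the position part of the plane wave becomes a modulation of `f`,
  -- absorbed into `g`. The momentum part replaces `x` by `x - w.1` in the inversion formula, and `ζ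
  -- = ξ/(2πh)` cancels the prefactor.
  let g : 𝓢(ℝ, ℂ) := SchwartzMap.smulLeftCLM ℂ
    (fun v : ℝ ↦ Complex.exp (Complex.I * (w.2 / (2 * h) * v + w.2 / (2 * h) * x : ℝ))) f
  have hg : ∀ v, g v =
      Complex.exp (Complex.I * (w.2 / (2 * h) * v + w.2 / (2 * h) * x : ℝ)) * f v := fun v ↦ by
    rw [SchwartzMap.smulLeftCLM_apply_apply (hasTemperateGrowth_cexp _ _), smul_eq_mul]
  have hhC : (h : ℂ) ≠ 0 := by exact_mod_cast hh.ne'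
  have hpi : (Real.pi : ℂ) ≠ 0 := by exact_mod_cast Real.pi_ne_zero
  have hc : 0 < 2 * Real.pi * h := by positivity
  have key := integral_fourier_inversion g (x - w.1)
  rw [translationSchwartz_apply, weylOp]
  have e1 : ∀ ξ : ℝ, ∫ x' : ℝ, Complex.exp (Complex.I / h * ((x - x') * ξ)) *
      planeWave h w ((x + x') / 2, ξ) * f x' =
      (fun ζ : ℝ ↦ Complex.exp (2 * Real.pi * Complex.I * ((x - w.1 : ℝ) * ζ)) *
        ∫ v : ℝ, Complex.exp (-2 * Real.pi * Complex.I * (v * ζ)) * g v)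
          ((2 * Real.pi * h)⁻¹ * ξ) := by
    intro ξ
    simp only
    rw [← integral_const_mul]
    refine integral_congr_ae (Filter.Eventually.of_forall fun v ↦ ?_)
    simp only [hg, planeWave, ← mul_assoc, ← Complex.exp_add]
    congr 2
    push_cast
    field_simp
    ring
  simp_rw [e1]
  rw [Measure.integral_comp_mul_left
    (fun ζ : ℝ ↦ Complex.exp (2 * Real.pi * Complex.I * ((x - w.1 : ℝ) * ζ)) *
        ∫ v : ℝ, Complex.exp (-2 * Real.pi * Complex.I * (v * ζ)) * g v), key, hg,
    inv_inv, abs_of_pos hc, Complex.real_smul, ← mul_assoc, ← Complex.ofReal_mul,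
    one_div_mul_cancel hc.ne', Complex.ofReal_one, one_mul]
  congr 2
  push_cast
  field_simp
  ring

theorem norm_translationSchwartz_apply (h : ℝ) (w : ℝ × ℝ) (f : 𝓢(ℝ, ℂ)) (x : ℝ) :
    ‖translationSchwartz h w f x‖ = ‖f (x - w.1)‖ := by
  rw [translationSchwartz_apply, norm_mul]
  have : Complex.I / h * (w.2 * x) - Complex.I / (2 * h) * (w.1 * w.2) =
      Complex.I * ((1 / h * (w.2 * x) - 1 / (2 * h) * (w.1 * w.2) : ℝ) : ℂ) := by
    push_cast
    ring
  rw [this, Complex.norm_exp_I_mul_ofReal, one_mul]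

theorem norm_toLp_translationSchwartz (h : ℝ) (w : ℝ × ℝ) (f : 𝓢(ℝ, ℂ)) :
    ‖(translationSchwartz h w f).toLp 2 volume‖ = ‖f.toLp 2 volume‖ := by
  rw [norm_toLp' (by simp) (by simp), norm_toLp' (by simp) (by simp)]
  simp_rw [norm_translationSchwartz_apply]
  rw [integral_sub_right_eq_self (fun x ↦ ‖f x‖ ^ (2 : ℝ≥0∞).toReal) w.1]

/-- The quantum translation `U_w` on `L²(ℝ)`. -/
def translationL2 (h : ℝ) (w : ℝ × ℝ) : L2 →L[ℂ] L2 :=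
  LinearMap.extendOfNorm (σ₁₂ := RingHom.id ℂ)
    ((toLpCLM ℂ ℂ 2 volume ∘L translationSchwartz h w : 𝓢(ℝ, ℂ) →L[ℂ] L2) : 𝓢(ℝ, ℂ) →ₗ[ℂ] L2)
    ((toLpCLM ℂ ℂ 2 volume : 𝓢(ℝ, ℂ) →L[ℂ] L2) : 𝓢(ℝ, ℂ) →ₗ[ℂ] L2)

theorem denseRange_toLp : DenseRange fun f : 𝓢(ℝ, ℂ) ↦ f.toLp 2 volume :=
  denseRange_toLpCLM (by simp)

theorem translationL2_toLp (h : ℝ) (w : ℝ × ℝ) (f : 𝓢(ℝ, ℂ)) :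
    translationL2 h w (f.toLp 2 volume) = (translationSchwartz h w f).toLp 2 volume :=
  LinearMap.extendOfNorm_eq denseRange_toLp
    ⟨1, fun f ↦ by
      rw [one_mul]
      exact (norm_toLp_translationSchwartz h w f).le⟩ f

theorem isWeylQuantization_translationL2 {h : ℝ} (hh : 0 < h) (w : ℝ × ℝ) :
    IsWeylQuantization h (planeWave h w) (translationL2 h w) := by
  intro f
  rw [translationL2_toLp]
  filter_upwards [coeFn_toLp (translationSchwartz h w f) 2 volume] with x hx
  rw [hx, weylOp_planeWave hh]

/-- A bounded operator is determined by its values on the dense Schwartz space. -/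
theorem IsWeylQuantization.eq_translationL2 {h : ℝ} (hh : 0 < h) {w : ℝ × ℝ} {T : L2 →L[ℂ] L2}
    (hT : IsWeylQuantization h (planeWave h w) T) : T = translationL2 h w := by
  refine ContinuousLinearMap.coeFn_injective
    (denseRange_toLp.equalizer T.continuous (translationL2 h w).continuous ?_)
  funext f
  exact Lp.ext ((hT f).trans (isWeylQuantization_translationL2 hh w f).symm)

/-- The exponent is the symplectic form of `w` and `z`, which a matrix of determinant one preserves.
-/
theorem planeWave_comp_phaseMap (h : ℝ) (A : Matrix.SpecialLinearGroup (Fin 2) ℝ) (w : ℝ × ℝ) :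
    planeWave h (phaseMap A w) ∘ phaseMap A = planeWave h w := by
  funext z
  have hdet := A.det_coe
  rw [Matrix.det_fin_two] at hdet
  simp only [planeWave, phaseMap, Function.comp]
  congr 4
  linear_combination (w.2 * z.1 - w.1 * z.2) * hdet

/-- Egorov's theorem for quantum translations, on `L²(ℝ)`. -/
theorem IsMetaplectic.translationL2_apply {h : ℝ} (hh : 0 < h)
    {A : Matrix.SpecialLinearGroup (Fin 2) ℝ} {M : L2 ≃ₗᵢ[ℂ] L2} (hM : IsMetaplectic h A M)
    (w : ℝ × ℝ) (f : L2) :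
    M (translationL2 h w f) = translationL2 h (phaseMap A w) (M f) := by
  have h1 := hM _ (isSymbol_planeWave h (phaseMap A w)) _
    (isWeylQuantization_translationL2 hh (phaseMap A w))
  rw [planeWave_comp_phaseMap] at h1
  rw [← h1.eq_translationL2 hh]
  simp

theorem toTemperedDistribution_translationL2 (h : ℝ) (w : ℝ × ℝ) (f : L2) :
    Lp.toTemperedDistribution (translationL2 h w f) =
      translation h w (Lp.toTemperedDistribution f) := by
  have hc : Continuous fun f : L2 ↦ Lp.toTemperedDistribution f :=
    (Lp.toTemperedDistributionCLM ℂ volume 2).continuous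
  refine congrFun (denseRange_toLp.equalizer (hc.comp (translationL2 h w).continuous)
    ((translation h w).continuous.comp hc) ?_) f
  funext g
  simp only [Function.comp]
  rw [translationL2_toLp, Lp.toTemperedDistribution_toLp_eq, Lp.toTemperedDistribution_toLp_eq,
    translation_coe]

/-! ### Continuous functionals on tempered distributions -/

/-- A continuous linear functional on `𝓢'(ℝ)` is the evaluation at a Schwartz function. -/
theorem exists_eq_apply_of_continuous (F : 𝓢'(ℝ, ℂ) →L[ℂ] ℂ) :
    ∃ ψ : 𝓢(ℝ, ℂ), ∀ u : 𝓢'(ℝ, ℂ), F u = u ψ := by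
  let B : 𝓢(ℝ, ℂ) →ₗ[ℂ] 𝓢'(ℝ, ℂ) →ₗ[ℂ] ℂ :=
    (PointwiseConvergenceCLM.coeLM ℂ 𝓢(ℝ, ℂ) ℂ).flip
  -- The topology on `𝓢'(ℝ)` is the weak topology induced by the evaluations, so a continuous
  -- functional is a finite combination of evaluations, which is again an evaluation.
  have hF : (F : 𝓢'(ℝ, ℂ) →ₗ[ℂ] ℂ) ∈ Submodule.span ℂ (Set.range B) := by
    rw [LinearMap.mem_span_iff_continuous, continuous_iff_le_induced]
    refine F.continuous.le_induced.trans' (le_of_eq ?_)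
    rw [(PointwiseConvergenceCLM.isEmbedding_coeFn (RingHom.id ℂ) 𝓢(ℝ, ℂ) ℂ).eq_induced,
      ← induced_to_pi]
    rfl
  have h2 : Submodule.span ℂ (Set.range B) ≤ LinearMap.range B :=
    Submodule.span_le.2 fun _ h ↦ h
  obtain ⟨ψ, hψ⟩ := h2 hF
  exact ⟨ψ, fun u ↦ (LinearMap.congr_fun hψ u).symm⟩

/-- The pairing `∫ g ψ` is symmetric, so `ψ` vanishes as a distribution; then `L²(ℝ)` embeds into
`𝓢'(ℝ)`. -/
theorem eq_zero_of_forall_coe_apply {ψ : 𝓢(ℝ, ℂ)}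
    (hψ : ∀ g : 𝓢(ℝ, ℂ), (g : 𝓢'(ℝ, ℂ)) ψ = 0) : ψ = 0 := by
  have h1 : (ψ : 𝓢'(ℝ, ℂ)) = 0 := by
    ext g
    have h := hψ g
    rw [SchwartzMap.coe_apply] at h ⊢
    change _ = (0 : ℂ)
    rw [← h]
    simp only [smul_eq_mul, mul_comm]
  rw [← Lp.toTemperedDistribution_toLp_eq (p := 2)] at h1
  have h2 : ψ.toLp 2 volume ∈ LinearMap.ker (Lp.toTemperedDistributionCLM ℂ volume 2).toLinearMap :=
    h1
  rw [Lp.ker_toTemperedDistributionCLM_eq_bot, Submodule.mem_bot] at h2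
  refine injective_toLp 2 volume (h2.trans ?_)
  exact (map_zero (toLpCLM ℂ ℂ 2 volume)).symm

/-- Takes the place of density of `𝓢(ℝ)` in `𝓢'(ℝ)`: tested against `φ`, the difference is
evaluation at some `ψ`, and `ψ = 0` since it is annihilated by all Schwartz functions. -/
theorem ext_of_forall_coe {P Q : 𝓢'(ℝ, ℂ) →L[ℂ] 𝓢'(ℝ, ℂ)}
    (hPQ : ∀ g : 𝓢(ℝ, ℂ), P (g : 𝓢'(ℝ, ℂ)) = Q (g : 𝓢'(ℝ, ℂ))) : P = Q := by
  ext u φ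
  obtain ⟨ψ, hψ⟩ := exists_eq_apply_of_continuous
    (PointwiseConvergenceCLM.evalCLM (RingHom.id ℂ) ℂ φ ∘L (P - Q))
  have h0 : ψ = 0 := eq_zero_of_forall_coe_apply fun g ↦ by
    rw [← hψ]
    simp [hPQ g]
  have h1 := hψ u
  rw [h0, map_zero] at h1
  exact sub_eq_zero.1 h1

/-- Egorov's theorem for quantum translations, on tempered distributions. -/
theorem IsMetaplectic.translation_apply {h : ℝ} (hh : 0 < h)
    {A : Matrix.SpecialLinearGroup (Fin 2) ℝ} {M : L2 ≃ₗᵢ[ℂ] L2} (hM : IsMetaplectic h A M)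
    {M' : 𝓢'(ℝ, ℂ) →L[ℂ] 𝓢'(ℝ, ℂ)} (hM' : IsDistributionExtension M M')
    (w : ℝ × ℝ) (u : 𝓢'(ℝ, ℂ)) :
    M' (translation h w u) = translation h (phaseMap A w) (M' u) := by
  have key : M' ∘L translation h w = translation h (phaseMap A w) ∘L M' := by
    refine ext_of_forall_coe fun g ↦ ?_
    simp only [ContinuousLinearMap.comp_apply]
    rw [← Lp.toTemperedDistribution_toLp_eq (p := 2), ← toTemperedDistribution_translationL2,
      hM', hM', hM.translationL2_apply hh, toTemperedDistribution_translationL2]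
  exact congrArg (fun P : 𝓢'(ℝ, ℂ) →L[ℂ] 𝓢'(ℝ, ℂ) ↦ P u) key

theorem exists_L2_ne_zero : ∃ f : L2, f ≠ 0 := by
  refine ⟨indicatorConstLp 2 (measurableSet_Icc (a := (0 : ℝ)) (b := 1)) (by simp) 1, fun h ↦ ?_⟩
  have h1 := congrArg norm h
  rw [norm_indicatorConstLp (by simp) (by simp), norm_zero] at h1
  simp at h1

/-- If the extension of a metaplectic operator kills `u`, then there is a nonzero Schwartz function
all of whose quantum translates are annihilated by `u`. -/
theorem IsMetaplectic.exists_forall_translation_apply_eq_zero {h : ℝ} (hh : 0 < h)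
    {A : Matrix.SpecialLinearGroup (Fin 2) ℝ} {M : L2 ≃ₗᵢ[ℂ] L2} (hM : IsMetaplectic h A M)
    {M' : 𝓢'(ℝ, ℂ) →L[ℂ] 𝓢'(ℝ, ℂ)} (hM' : IsDistributionExtension M M')
    {u : 𝓢'(ℝ, ℂ)} (hu : M' u = 0) :
    ∃ ψ : 𝓢(ℝ, ℂ), ψ ≠ 0 ∧ ∀ w, translation h w u ψ = 0 := by
  obtain ⟨g, φ, hgφ⟩ : ∃ g φ : 𝓢(ℝ, ℂ), M' (g : 𝓢'(ℝ, ℂ)) φ ≠ 0 := by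
    by_contra! hcon
    have h0 : M' = 0 := ext_of_forall_coe fun g ↦ by
      ext φ
      exact hcon g φ
    obtain ⟨f, hf⟩ := exists_L2_ne_zero
    have h1 := hM' f
    rw [h0, zero_apply] at h1
    have h2 : M f ∈ LinearMap.ker (Lp.toTemperedDistributionCLM ℂ volume 2).toLinearMap := h1.symm
    rw [Lp.ker_toTemperedDistributionCLM_eq_bot, Submodule.mem_bot] at h2
    exact hf (by simpa using h2)
  -- `ψ` is the image of `φ` under the transpose of `M'`; since `M'` maps translates of `u` to
  -- translates of `M' u = 0`, they all vanish on `ψ`.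
  obtain ⟨ψ, hψ⟩ := exists_eq_apply_of_continuous
    (PointwiseConvergenceCLM.evalCLM (RingHom.id ℂ) ℂ φ ∘L M')
  have hψ' : ∀ u : 𝓢'(ℝ, ℂ), M' u φ = u ψ := hψ
  refine ⟨ψ, ?_, fun w ↦ ?_⟩
  · rintro rfl
    exact hgφ ((hψ' _).trans (map_zero _))
  · rw [← hψ', hM.translation_apply hh hM', hu, map_zero]
    rfl

/-! ### Quantum translations of Dirac combs -/

theorem planck_pos {N : ℕ} (hN : N ≠ 0) : 0 < planck N := by
  have : (0 : ℝ) < N := by positivity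
  unfold planck
  positivity

theorem comb_add_int (t : ℝ) (n : ℤ) : comb (t + n) = comb t := by
  ext φ
  rw [comb_apply, comb_apply, ← (Equiv.addRight n).tsum_eq (fun k : ℤ ↦ φ (t + k))]
  refine tsum_congr fun k ↦ congrArg φ ?_
  simp only [Equiv.coe_addRight]
  push_cast
  ring

theorem translation_comb {N : ℕ} (hN : N ≠ 0) (j m n : ℤ) :
    translation (planck N) ((m : ℝ) / N, (n : ℝ) / N) (comb (j / N)) =
      Complex.exp (Real.pi * Complex.I * (n * (2 * j + m)) / N) • comb ((j + m : ℤ) / N) := by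
  have hNC : (N : ℂ) ≠ 0 := by exact_mod_cast hN
  have hpi : (Real.pi : ℂ) ≠ 0 := by exact_mod_cast Real.pi_ne_zero
  ext φ
  rw [translation_apply]
  change comb _ _ = _ * comb _ φ
  rw [comb_apply, comb_apply, ← tsum_mul_left]
  refine tsum_congr fun k ↦ ?_
  rw [translationSchwartz_apply]
  congr 1
  · rw [Complex.exp_eq_exp_iff_exists_int]
    -- The phase at the `k`-th atom differs from that at `k = 0` by `exp(2πi n k) = 1`.
    refine ⟨n * k, ?_⟩
    simp only [planck]
    push_cast
    field_simp
    ring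
  · congr 1
    push_cast
    ring

/-! ### The discrete Heisenberg representation -/

/-- The residue of `j + m` modulo `N`. -/
def shift {N : ℕ} (m : ℤ) (j : Fin N) : Fin N :=
  ⟨((j + m) % N : ℤ).toNat, by
    have hN : (0 : ℤ) < N := by exact_mod_cast j.pos
    have h1 := Int.emod_nonneg ((j : ℤ) + m) hN.ne'
    have h2 := Int.emod_lt_of_pos ((j : ℤ) + m) hN
    omega⟩

theorem coe_shift {N : ℕ} (m : ℤ) (j : Fin N) : ((shift m j : ℕ) : ℤ) = (j + m) % N := by
  have hN : (0 : ℤ) < N := by exact_mod_cast j.pos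
  exact Int.toNat_of_nonneg (Int.emod_nonneg _ hN.ne')

theorem eq_shift_iff {N : ℕ} (m : ℤ) (i j : Fin N) : i = shift m j ↔ (N : ℤ) ∣ i - j - m := by
  have hi : ((i : ℕ) : ℤ) % N = i := Int.emod_eq_of_lt (by positivity) (by exact_mod_cast i.isLt)
  rw [Fin.ext_iff, ← Int.natCast_inj, coe_shift]
  nth_rw 1 [← hi]
  rw [eq_comm, ← Int.ModEq, Int.modEq_iff_dvd, sub_sub]

theorem shift_injective {N : ℕ} (m : ℤ) : Function.Injective (shift (N := N) m) := by
  intro j j' h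
  have h1 := (eq_shift_iff m (shift m j) j).1 rfl
  have h2 := (eq_shift_iff m (shift m j) j').1 h
  have h3 : (N : ℤ) ∣ j - j' - 0 := by
    have := dvd_sub h2 h1
    refine this.trans (dvd_of_eq ?_)
    ring
  rw [← eq_shift_iff] at h3
  rw [h3]
  apply Fin.ext
  zify
  rw [coe_shift, add_zero]
  exact Int.emod_eq_of_lt (by positivity) (by exact_mod_cast j'.isLt)

/-- The phase of the matrix entry of the quantum translation by `(m, n) / N` in column `j`. -/
def heisenbergPhase (N : ℕ) (m n j : ℤ) : ℂ :=
  Complex.exp (Complex.I * (Real.pi * (n * (2 * j + m)) / N : ℝ))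

theorem norm_heisenbergPhase (N : ℕ) (m n j : ℤ) : ‖heisenbergPhase N m n j‖ = 1 :=
  Complex.norm_exp_I_mul_ofReal _

/-- The matrix of the quantum translation by `(m, n) / N` in the basis `e_0, …, e_{N-1}`. -/
def heisenberg (N : ℕ) (m n : ℤ) : Matrix (Fin N) (Fin N) ℂ :=
  Matrix.of fun i j ↦ if i = shift m j then heisenbergPhase N m n j else 0

theorem heisenberg_apply (N : ℕ) (m n : ℤ) (i j : Fin N) :
    heisenberg N m n i j = if i = shift m j then heisenbergPhase N m n j else 0 := rfl

open Matrix in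
theorem conjTranspose_heisenberg_mul (N : ℕ) (m n : ℤ) :
    (heisenberg N m n)ᴴ * heisenberg N m n = 1 := by
  ext j j'
  simp only [mul_apply, conjTranspose_apply, heisenberg_apply, mul_ite, mul_zero]
  rw [Finset.sum_ite_eq' Finset.univ]
  simp only [Finset.mem_univ, if_true, (shift_injective m).eq_iff]
  by_cases h : j = j'
  · subst h
    rw [one_apply_eq, if_pos rfl, Complex.star_def, Complex.conj_mul', norm_heisenbergPhase]
    simp
  · rw [one_apply_ne h, if_neg (Ne.symm h)]
    simp

/-- The matrix permutes the basis states up to phases, and the permutation has a fixed point only if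
`m` is zero modulo `N`. -/
theorem norm_heisenberg_diag_le (N : ℕ) (m n : ℤ) (j : Fin N) :
    ‖heisenberg N m n j j‖ ≤ if (N : ℤ) ∣ m then 1 else 0 := by
  have : j = shift m j ↔ (N : ℤ) ∣ m := by
    rw [eq_shift_iff, sub_self, zero_sub, dvd_neg]
  rw [heisenberg_apply]
  simp only [this]
  split_ifs <;> simp [norm_heisenbergPhase]

/-- The quantum state with given coordinates. -/
def ofCoords (N : ℕ) : (Fin N → ℂ) →ₗ[ℂ] 𝓢'(ℝ, ℂ) := Fintype.linearCombination ℂ (basisState N)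

theorem ofCoords_apply (N : ℕ) (c : Fin N → ℂ) : ofCoords N c = ∑ j, c j • basisState N j :=
  Fintype.linearCombination_apply _ _ _

theorem ofCoords_injective (N : ℕ) : Function.Injective (ofCoords N) :=
  (basisState_linearIndependent N).fintypeLinearCombination_injective

theorem translation_basisState {N : ℕ} (m n : ℤ) (j : Fin N) :
    translation (planck N) ((m : ℝ) / N, (n : ℝ) / N) (basisState N j) =
      heisenbergPhase N m n j • basisState N (shift m j) := by
  have hN : N ≠ 0 := j.pos.ne'
  have hNR : (N : ℝ) ≠ 0 := by exact_mod_cast hN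
  have h1 := translation_comb hN (j : ℕ) m n
  have h2 : comb (((j : ℕ) + m : ℤ) / N) = comb ((shift m j : ℕ) / N) := by
    rw [← comb_add_int ((shift m j : ℕ) / N) (((j : ℕ) + m) / N)]
    congr 1
    have h3 : (((j : ℕ) + m : ℤ) : ℝ) =
        ((shift m j : ℕ) : ℝ) + N * ((((j : ℕ) + m) / N : ℤ) : ℝ) := by
      have := coe_shift m j
      have h4 := Int.emod_add_mul_ediv ((j : ℕ) + m : ℤ) N
      rw [← this] at h4
      exact_mod_cast h4.symm
    rw [h3]
    field_simp
  have h3 : heisenbergPhase N m n j =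
      Complex.exp (Real.pi * Complex.I * (n * (2 * ((j : ℕ) : ℤ) + m)) / N) := by
    rw [heisenbergPhase]
    congr 1
    push_cast
    ring
  rw [h2, Int.cast_natCast] at h1
  rw [h3, basisState, map_smul, h1, basisState, smul_comm]

theorem ofCoords_apply_apply (N : ℕ) (c : Fin N → ℂ) (φ : 𝓢(ℝ, ℂ)) :
    ofCoords N c φ = ∑ j, c j * basisState N j φ := by
  rw [ofCoords_apply, sum_apply]
  rfl

theorem translation_ofCoords {N : ℕ} (m n : ℤ) (c : Fin N → ℂ) :
    translation (planck N) ((m : ℝ) / N, (n : ℝ) / N) (ofCoords N c) =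
      ofCoords N ((heisenberg N m n).mulVec c) := by
  have h1 : ∀ i, (heisenberg N m n).mulVec c i =
      ∑ j, (if i = shift m j then heisenbergPhase N m n j else 0) * c j := fun i ↦ rfl
  ext φ
  rw [translation_apply, ofCoords_apply_apply, ofCoords_apply_apply]
  have h2 : ∀ j, basisState N j (translationSchwartz (planck N) (-((m : ℝ) / N), (n : ℝ) / N) φ) =
      heisenbergPhase N m n j * basisState N (shift m j) φ := fun j ↦
    congrArg (fun u : 𝓢'(ℝ, ℂ) ↦ u φ) (translation_basisState m n j)
  simp_rw [h1, h2, Finset.sum_mul]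
  rw [Finset.sum_comm]
  refine Finset.sum_congr rfl fun j _ ↦ ?_
  simp only [ite_mul, zero_mul, Finset.sum_ite_eq', Finset.mem_univ, if_true]
  ring

/-- Orthogonality of the characters of `ℤ/N`, by summing a geometric series. -/
theorem sum_cexp_eq {N : ℕ} (i j : Fin N) :
    ∑ l ∈ Finset.range N, Complex.exp (2 * Real.pi * Complex.I * (j - i) / N) ^ l =
      if i = j then (N : ℂ) else 0 := by
  split_ifs with h
  · subst h
    simp
  · have hN : (N : ℂ) ≠ 0 := by exact_mod_cast j.pos.ne'
    have h1 : Complex.exp (2 * Real.pi * Complex.I * (j - i) / N) ≠ 1 := by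
      intro h1
      rw [Complex.exp_eq_one_iff] at h1
      obtain ⟨n, hn⟩ := h1
      have hpi : (Real.pi : ℂ) ≠ 0 := by exact_mod_cast Real.pi_ne_zero
      have h2 : (j : ℂ) - i = N * n := by
        field_simp at hn
        have h3 : (2 * Real.pi * Complex.I : ℂ) ≠ 0 := Complex.two_pi_I_ne_zero
        apply mul_left_cancel₀ h3
        linear_combination (2 * Real.pi * Complex.I) * hn
      have h3 : ((j : ℕ) : ℤ) - (i : ℕ) = N * n := by exact_mod_cast h2
      have hj := j.isLt
      have hi := i.isLt
      have hn0 : n = 0 := by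
        rcases lt_trichotomy n 0 with hk | hk | hk
        · nlinarith
        · exact hk
        · nlinarith
      subst hn0
      exact h (Fin.ext (by omega))
    have h2 : Complex.exp (2 * Real.pi * Complex.I * (j - i) / N) ^ N = 1 := by
      rw [← Complex.exp_nat_mul, mul_div_cancel₀ _ hN, Complex.exp_eq_one_iff]
      exact ⟨(j : ℕ) - (i : ℕ), by push_cast; ring⟩
    rw [geom_sum_eq h1, h2, sub_self, zero_div]

/-- The projection to the `i`-th basis state is an average of quantum translations. -/
theorem sum_smul_heisenberg {N : ℕ} (i : Fin N) :
    ∑ l ∈ Finset.range N, Complex.exp (-(2 * Real.pi * Complex.I * i / N)) ^ l •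
      heisenberg N 0 l = (N : ℂ) • Matrix.single i i (1 : ℂ) := by
  ext j j'
  have hs : shift 0 j' = j' := by
    symm
    rw [eq_shift_iff]
    simp
  rw [Matrix.sum_apply]
  simp only [Matrix.smul_apply, heisenberg_apply, hs, smul_eq_mul]
  by_cases h : j = j'
  · subst h
    have := sum_cexp_eq i j
    simp only [if_true]
    rw [Matrix.single_apply]
    simp only [and_self, mul_ite, mul_one, mul_zero]
    rw [← this]
    refine Finset.sum_congr rfl fun l _ ↦ ?_
    rw [heisenbergPhase, ← Complex.exp_nat_mul, ← Complex.exp_nat_mul, ← Complex.exp_add]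
    congr 1
    push_cast
    ring
  · simp only [if_neg h, mul_zero, Finset.sum_const_zero]
    rw [Matrix.single_apply_of_ne]
    · simp
    · rintro ⟨rfl, rfl⟩
      exact h rfl

/-- The discrete Heisenberg representation is irreducible. -/
theorem eq_top_of_heisenberg_invariant {N : ℕ} {p : Submodule ℂ (Fin N → ℂ)}
    (hp : ∀ m n : ℤ, ∀ c ∈ p, (heisenberg N m n).mulVec c ∈ p) {c : Fin N → ℂ} (hc : c ∈ p)
    (hc0 : c ≠ 0) : p = ⊤ := by
  obtain ⟨i, hi⟩ := Function.ne_iff.1 hc0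
  have hN : (N : ℂ) ≠ 0 := by exact_mod_cast i.pos.ne'
  have h1 : Pi.single i (1 : ℂ) ∈ p := by
    have h2 := congrArg (fun B ↦ Matrix.mulVec B c) (sum_smul_heisenberg i)
    simp only [Matrix.sum_mulVec, Matrix.smul_mulVec] at h2
    have h3 : Matrix.mulVec (Matrix.single i i (1 : ℂ)) c = c i • Pi.single i (1 : ℂ) := by
      rw [Matrix.single_mulVec]
      ext k
      simp [Pi.single_apply, Function.update_apply]
    rw [h3, smul_smul] at h2
    have h4 : ((N : ℂ) * c i) • Pi.single i (1 : ℂ) ∈ p := by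
      rw [← h2]
      exact Submodule.sum_mem _ fun l _ ↦ Submodule.smul_mem _ _ (hp _ _ _ hc)
    exact (Submodule.smul_mem_iff _ (mul_ne_zero hN hi)).1 h4
  -- The other basis vectors are position shifts of the one already found.
  have h2 : ∀ j, Pi.single j (1 : ℂ) ∈ p := by
    intro j
    have h3 := hp (j - i) 0 _ h1
    convert h3 using 1
    rw [Matrix.mulVec_single_one]
    ext k
    have h4 : j = shift ((j : ℤ) - i) i := by
      rw [eq_shift_iff]
      simp
    simp only [Matrix.col_apply, heisenberg_apply, ← h4, Pi.single_apply]
    simp [heisenbergPhase]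
  rw [eq_top_iff]
  rintro x -
  rw [pi_eq_sum_univ' x]
  refine Submodule.sum_mem _ fun j _ ↦ Submodule.smul_mem _ _ ?_
  convert h2 j using 1

/-! ### Injectivity of metaplectic operators on quantum states -/

theorem integral_cexp_int_mul (m : ℤ) :
    ∫ η : ℝ in (0 : ℝ)..1, Complex.exp (2 * Real.pi * Complex.I * m * η) =
      if m = 0 then 1 else 0 := by
  split_ifs with h
  · simp [h]
  · have h1 : (2 * Real.pi * Complex.I * m : ℂ) ≠ 0 :=
      mul_ne_zero Complex.two_pi_I_ne_zero (by exact_mod_cast h)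
    rw [integral_exp_mul_complex h1]
    have h2 : Complex.exp (2 * Real.pi * Complex.I * m * (1 : ℝ)) = 1 := by
      rw [Complex.exp_eq_one_iff]
      exact ⟨m, by push_cast; ring⟩
    rw [h2]
    simp

theorem norm_cexp_int_mul (m : ℤ) (η : ℝ) :
    ‖Complex.exp (2 * Real.pi * Complex.I * m * η)‖ = 1 := by
  rw [← Complex.norm_exp_I_mul_ofReal (2 * Real.pi * m * η)]
  congr 2
  push_cast
  ring

theorem continuous_tsum_cexp {b : ℤ → ℂ} (hb : Summable b) (m : ℤ → ℤ) :
    Continuous fun η : ℝ ↦ ∑' k, Complex.exp (2 * Real.pi * Complex.I * m k * η) * b k := by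
  refine continuous_tsum (fun k ↦ by fun_prop) hb.norm fun k η ↦ ?_
  rw [norm_mul, norm_cexp_int_mul, one_mul]

theorem integral_tsum_cexp {b : ℤ → ℂ} (hb : Summable b) (m : ℤ → ℤ) :
    ∫ η : ℝ in (0 : ℝ)..1, ∑' k, Complex.exp (2 * Real.pi * Complex.I * m k * η) * b k =
      ∑' k, if m k = 0 then b k else 0 := by
  rw [intervalIntegral.integral_of_le zero_le_one]
  have hc : ∀ k, Continuous fun η : ℝ ↦ Complex.exp (2 * Real.pi * Complex.I * m k * η) * b k :=
    fun k ↦ by fun_prop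
  have h := hasSum_integral_of_summable_integral_norm
    (μ := volume.restrict (Set.Ioc (0 : ℝ) 1))
    (F := fun k (η : ℝ) ↦ Complex.exp (2 * Real.pi * Complex.I * m k * η) * b k)
    (fun k ↦ ((hc k).integrableOn_Icc (a := 0) (b := 1)).mono_set Set.Ioc_subset_Icc_self)
    (by
      simp only [norm_mul, norm_cexp_int_mul, one_mul]
      simpa using hb.norm)
  rw [← h.tsum_eq]
  refine tsum_congr fun k ↦ ?_
  rw [← intervalIntegral.integral_of_le zero_le_one, intervalIntegral.integral_mul_const,
    integral_cexp_int_mul]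
  simp

/-- The quantum translates of a nonzero Schwartz function separate the quantum states. -/
theorem eq_zero_of_forall_translation_apply_eq_zero {N : ℕ} {c : Fin N → ℂ} {ψ : 𝓢(ℝ, ℂ)}
    (hψ : ψ ≠ 0) (h : ∀ w, translation (planck N) w (ofCoords N c) ψ = 0) : c = 0 := by
  obtain ⟨x, hx⟩ : ∃ x, ψ x ≠ 0 := by
    by_contra! h0
    exact hψ (SchwartzMap.ext h0)
  funext i
  have hN : N ≠ 0 := i.pos.ne'
  have hNC : (N : ℂ) ≠ 0 := by exact_mod_cast hN
  have hNR : (N : ℝ) ≠ 0 := by exact_mod_cast hN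
  -- This shift evaluates `ψ` at `x` for the atom `j = i`, `k = 0`. Letting the momentum `η` vary
  -- and removing a common phase leaves a trigonometric series in which exactly this atom has
  -- frequency zero, so integration over `[0, 1]` isolates `c i * ψ x`.
  set a : ℝ := x - (i : ℕ) / N with ha
  let b : Fin N → ℤ → ℂ := fun j k ↦ ψ (((j : ℕ) / N + a) + k)
  let m : Fin N → ℤ → ℤ := fun j k ↦ j + N * k - i
  have hb : ∀ j, Summable (b j) := fun j ↦ comb_summable _ ψ
  have h0 : ∀ η : ℝ, ∑ j, c j *
      ∑' k, Complex.exp (2 * Real.pi * Complex.I * m j k * η) * b j k = 0 := by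
    intro η
    have h1 := h (a, η)
    rw [translation_apply, ofCoords_apply_apply] at h1
    simp only [basisState_apply, translationSchwartz_apply] at h1
    have h2 : ∀ (j : Fin N) (k : ℤ),
        Complex.exp (Complex.I / (planck N) * (η * ((j : ℕ) / N + k : ℝ)) -
          Complex.I / (2 * planck N) * ((-a : ℝ) * η)) * ψ ((j : ℕ) / N + k - -a) =
        Complex.exp (2 * Real.pi * Complex.I * i * η + Real.pi * Complex.I * N * a * η) *
          (Complex.exp (2 * Real.pi * Complex.I * m j k * η) * b j k) := by
      intro j k
      rw [← mul_assoc (Complex.exp (_ + _)), ← Complex.exp_add]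
      congr 2
      · simp only [m, planck]
        push_cast
        field_simp
        ring
      · ring
    simp only [h2, tsum_mul_left] at h1
    have h3 : ∀ j, c j * (((1 / Real.sqrt N : ℝ) : ℂ) *
        (Complex.exp (2 * Real.pi * Complex.I * i * η + Real.pi * Complex.I * N * a * η) *
          ∑' k, Complex.exp (2 * Real.pi * Complex.I * m j k * η) * b j k)) =
        (((1 / Real.sqrt N : ℝ) : ℂ) *
          Complex.exp (2 * Real.pi * Complex.I * i * η + Real.pi * Complex.I * N * a * η)) *
        (c j * ∑' k, Complex.exp (2 * Real.pi * Complex.I * m j k * η) * b j k) :=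
      fun j ↦ by ring
    rw [Finset.sum_congr rfl fun j _ ↦ h3 j, ← Finset.mul_sum] at h1
    refine (mul_eq_zero.1 h1).resolve_left (mul_ne_zero ?_ (Complex.exp_ne_zero _))
    simpa using hN
  have h1 : ∫ η : ℝ in (0 : ℝ)..1, ∑ j, c j *
      ∑' k, Complex.exp (2 * Real.pi * Complex.I * m j k * η) * b j k = 0 := by
    simp only [h0, intervalIntegral.integral_zero]
  rw [intervalIntegral.integral_finsetSum fun j _ ↦
    ((continuous_tsum_cexp (hb j) (m j)).const_mul (c j)).intervalIntegrable _ _] at h1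
  simp only [intervalIntegral.integral_const_mul, integral_tsum_cexp (hb _)] at h1
  have h2 : ∀ j k, m j k = 0 ↔ j = i ∧ k = 0 := by
    intro j k
    constructor
    · intro hm
      simp only [m] at hm
      have hj := j.isLt
      have hi := i.isLt
      have hk : k = 0 := by
        rcases lt_trichotomy k 0 with hk | hk | hk
        · nlinarith
        · exact hk
        · nlinarith
      subst hk
      refine ⟨Fin.ext ?_, rfl⟩
      simp at hm
      omega
    · rintro ⟨rfl, rfl⟩
      simp [m]
  simp only [h2] at h1
  rw [Finset.sum_eq_single i (fun j _ hj ↦ by simp [hj]) (by simp)] at h1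
  rw [tsum_eq_single 0 (fun k hk ↦ by simp [hk])] at h1
  simp only [and_self, if_true, b, ha] at h1
  have h3 : ((i : ℕ) / N + (x - (i : ℕ) / N) + ((0 : ℤ) : ℝ) : ℝ) = x := by
    push_cast
    ring
  rw [h3] at h1
  exact (mul_eq_zero.1 h1).resolve_right hx

/-! ### The matrix of a quantum cat map -/

open Matrix in
/-- `R` implements the automorphism `A` of the lattice of quantum translations. -/
def Intertwines (N : ℕ) (A : Matrix (Fin 2) (Fin 2) ℤ) (R : Matrix (Fin N) (Fin N) ℂ) : Prop :=
  ∀ m n : ℤ, R * heisenberg N m n =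
    heisenberg N (A 0 0 * m + A 0 1 * n) (A 1 0 * m + A 1 1 * n) * R

theorem Intertwines.smul {N : ℕ} {A : Matrix (Fin 2) (Fin 2) ℤ} {R : Matrix (Fin N) (Fin N) ℂ}
    (hR : Intertwines N A R) (z : ℂ) : Intertwines N A (z • R) := fun m n ↦ by
  rw [Matrix.smul_mul, hR, Matrix.mul_smul]

theorem Intertwines.mul {N : ℕ} {A B : Matrix (Fin 2) (Fin 2) ℤ} {R S : Matrix (Fin N) (Fin N) ℂ}
    (hR : Intertwines N A R) (hS : Intertwines N B S) : Intertwines N (A * B) (R * S) :=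
  fun m n ↦ by
    rw [Matrix.mul_assoc, hS, ← Matrix.mul_assoc, hR, Matrix.mul_assoc]
    congr 2
    all_goals
      simp only [Matrix.mul_apply, Fin.sum_univ_two]
      ring

theorem Intertwines.one (N : ℕ) : Intertwines N 1 1 := fun m n ↦ by simp

theorem Intertwines.pow {N : ℕ} {A : Matrix (Fin 2) (Fin 2) ℤ} {R : Matrix (Fin N) (Fin N) ℂ}
    (hR : Intertwines N A R) (k : ℕ) : Intertwines N (A ^ k) (R ^ k) := by
  induction k with
  | zero => simpa using Intertwines.one N
  | succ k ih => rw [pow_succ, pow_succ]; exact ih.mul hR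

/-- Schur's lemma for the discrete Heisenberg representation. -/
theorem exists_eq_smul_one_of_commute {N : ℕ} (hN : N ≠ 0) {D : Matrix (Fin N) (Fin N) ℂ}
    (hD : ∀ m n : ℤ, D * heisenberg N m n = heisenberg N m n * D) : ∃ s : ℂ, D = s • 1 := by
  have : NeZero N := ⟨hN⟩
  obtain ⟨s, hs⟩ := Module.End.exists_eigenvalue (Matrix.toLin' D)
  obtain ⟨v, hv⟩ := hs.exists_hasEigenvector
  refine ⟨s, ?_⟩
  have htop : Module.End.eigenspace (Matrix.toLin' D) s = ⊤ := by
    refine eq_top_of_heisenberg_invariant (fun m n c hc ↦ ?_) hv.1 hv.2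
    rw [Module.End.mem_eigenspace_iff, Matrix.toLin'_apply] at hc ⊢
    rw [Matrix.mulVec_mulVec, hD, ← Matrix.mulVec_mulVec, hc, Matrix.mulVec_smul]
  apply Matrix.toLin'.injective
  refine LinearMap.ext fun c ↦ ?_
  have hc : c ∈ Module.End.eigenspace (Matrix.toLin' D) s := htop ▸ Submodule.mem_top
  rw [Module.End.mem_eigenspace_iff] at hc
  rw [hc]
  simp

open Matrix in
-- Since Heisenberg matrices are unitary, `Sᴴ * S` does not change when `S` is multiplied by one on
-- the left; intertwining turns this into invariance under conjugation, as Schur's lemma requires.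
theorem Intertwines.conjTranspose_mul_commute {N : ℕ} {A : Matrix (Fin 2) (Fin 2) ℤ}
    {S : Matrix (Fin N) (Fin N) ℂ} (hS : Intertwines N A S) (m n : ℤ) :
    Sᴴ * S * heisenberg N m n = heisenberg N m n * (Sᴴ * S) := by
  have h1 : (heisenberg N m n)ᴴ * (Sᴴ * S) * heisenberg N m n = Sᴴ * S := by
    calc (heisenberg N m n)ᴴ * (Sᴴ * S) * heisenberg N m n
        = (S * heisenberg N m n)ᴴ * (S * heisenberg N m n) := by
          rw [conjTranspose_mul]; simp only [Matrix.mul_assoc]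
      _ = Sᴴ * S := by
          rw [hS, conjTranspose_mul, Matrix.mul_assoc, ← Matrix.mul_assoc _ᴴ _ S,
            conjTranspose_heisenberg_mul, Matrix.one_mul]
  have h2 := mul_eq_one_comm.1 (conjTranspose_heisenberg_mul N m n)
  calc Sᴴ * S * heisenberg N m n
      = (heisenberg N m n * (heisenberg N m n)ᴴ) * (Sᴴ * S * heisenberg N m n) := by
        rw [h2, Matrix.one_mul]
    _ = heisenberg N m n * ((heisenberg N m n)ᴴ * (Sᴴ * S) * heisenberg N m n) := by
        simp only [Matrix.mul_assoc]
    _ = _ := by rw [h1]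

open Matrix ComplexOrder in
/-- Normalizing an intertwiner by a nonzero eigenvalue makes it unitary. -/
theorem Intertwines.exists_unitary {N : ℕ} {A : Matrix (Fin 2) (Fin 2) ℤ}
    {S : Matrix (Fin N) (Fin N) ℂ} (hS : Intertwines N A S) {c : Fin N → ℂ} (hc : c ≠ 0)
    {μ : ℂ} (hμ : μ ≠ 0) (hSc : S *ᵥ c = μ • c) :
    ∃ R : Matrix (Fin N) (Fin N) ℂ, Intertwines N A R ∧ Rᴴ * R = 1 ∧ R *ᵥ c = c := by
  have hN : N ≠ 0 := by
    obtain ⟨i, -⟩ := Function.ne_iff.1 hc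
    exact i.pos.ne'
  obtain ⟨s, hs⟩ := exists_eq_smul_one_of_commute hN hS.conjTranspose_mul_commute
  -- Evaluating the scalar matrix `Sᴴ * S` on the eigenvector identifies it as `|μ|²`.
  have hs2 : s = star μ * μ := by
    have h1 : star c ⬝ᵥ ((Sᴴ * S) *ᵥ c) = star (S *ᵥ c) ⬝ᵥ (S *ᵥ c) := by
      rw [← Matrix.mulVec_mulVec, Matrix.star_mulVec, ← Matrix.dotProduct_mulVec]
    rw [hs, hSc, Matrix.smul_mulVec, Matrix.one_mulVec, star_smul, dotProduct_smul, smul_dotProduct,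
      dotProduct_smul, smul_eq_mul, smul_eq_mul, smul_eq_mul, ← mul_assoc] at h1
    refine mul_right_cancel₀ ?_ h1
    rwa [Ne, dotProduct_star_self_eq_zero]
  refine ⟨μ⁻¹ • S, hS.smul _, ?_, ?_⟩
  · rw [conjTranspose_smul, Matrix.smul_mul, Matrix.mul_smul, hs, hs2, smul_smul, smul_smul,
      star_inv₀]
    have : star μ ≠ 0 := by simpa using hμ
    rw [show (star μ)⁻¹ * μ⁻¹ * (star μ * μ) = 1 by field_simp, one_smul]
  · rw [Matrix.smul_mulVec, hSc, smul_smul, inv_mul_cancel₀ hμ, one_smul]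

open Matrix in
/-- The diagonal entries of a unitary intertwiner are small. -/
theorem Intertwines.norm_diag_sq_le {N : ℕ} {A : Matrix (Fin 2) (Fin 2) ℤ}
    {R : Matrix (Fin N) (Fin N) ℂ} (hR : Intertwines N A R) (hR1 : Rᴴ * R = 1) (hA : A 0 1 ≠ 0)
    (i : Fin N) : ‖R i i‖ ^ 2 ≤ |(A 0 1 : ℝ)| / N := by
  have hN : (0 : ℝ) < N := by exact_mod_cast i.pos
  have hR2 : R * Rᴴ = 1 := mul_eq_one_comm.1 hR1
  have h1 : (R * Matrix.single i i (1 : ℂ) * Rᴴ) i i = R i i * star (R i i) := by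
    simp [Matrix.mul_apply, Matrix.single_apply, Finset.sum_ite_eq, ite_and]
  have h2 := congrArg (fun B ↦ (R * B * Rᴴ) i i) (sum_smul_heisenberg i)
  simp only [Matrix.mul_smul, Matrix.smul_mul, Matrix.smul_apply, h1, smul_eq_mul] at h2
  rw [Finset.mul_sum, Finset.sum_mul, Matrix.sum_apply] at h2
  -- Conjugation makes momentum translations into translations whose position part is `A 0 1 * l`,
  -- so most of them lose their diagonal.
  have h3 : ∀ l : ℕ, R * heisenberg N 0 l * Rᴴ = heisenberg N (A 0 1 * l) (A 1 1 * l) := by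
    intro l
    rw [hR, Matrix.mul_assoc, hR2, Matrix.mul_one]
    simp
  simp only [Matrix.mul_smul, Matrix.smul_mul, Matrix.smul_apply, h3, smul_eq_mul] at h2
  have h4 : (N : ℝ) * ‖R i i‖ ^ 2 = ‖(N : ℂ) * (R i i * star (R i i))‖ := by
    rw [norm_mul, norm_mul, norm_star, Complex.norm_natCast, sq]
  rw [le_div_iff₀' hN, h4, ← h2]
  refine (norm_sum_le _ _).trans ?_
  have h5 : ∀ l ∈ Finset.range N, ‖Complex.exp (-(2 * Real.pi * Complex.I * i / N)) ^ l *
      heisenberg N (A 0 1 * l) (A 1 1 * l) i i‖ ≤ if (N : ℤ) ∣ A 0 1 * l then 1 else 0 := by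
    intro l _
    have h6 : ‖Complex.exp (-(2 * Real.pi * Complex.I * i / N))‖ = 1 := by
      rw [← Complex.norm_exp_I_mul_ofReal (-(2 * Real.pi * i / N))]
      congr 2
      push_cast
      ring
    rw [norm_mul, norm_pow, h6, one_pow, one_mul]
    exact norm_heisenberg_diag_le _ _ _ _
  refine (Finset.sum_le_sum h5).trans ?_
  rw [Finset.sum_boole]
  have h7 : ((Finset.range N).filter fun l : ℕ ↦ (N : ℤ) ∣ A 0 1 * l).card ≤
      (Finset.range (A 0 1).natAbs).card := by
    -- If `N ∣ b l` and `l < N`, the quotient `|b| l / N` is less than `|b|` and determines `l`.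
    refine Finset.card_le_card_of_injOn (fun l ↦ (A 0 1).natAbs * l / N) ?_ ?_
    · intro l hl
      simp only [Finset.coe_filter, Finset.mem_range, Set.mem_ofPred_eq] at hl
      simp only [Finset.coe_range, Set.mem_Iio]
      rw [Nat.div_lt_iff_lt_mul i.pos]
      exact Nat.mul_lt_mul_of_pos_left hl.1 (Int.natAbs_pos.2 hA)
    · intro l hl l' hl' h
      simp only [Finset.coe_filter, Finset.mem_range, Set.mem_ofPred_eq] at hl hl'
      have hd : ∀ l : ℕ, (N : ℤ) ∣ A 0 1 * l → N ∣ (A 0 1).natAbs * l := fun l hl ↦ by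
        have := Int.natAbs_dvd_natAbs.2 hl
        rwa [Int.natAbs_mul, Int.natAbs_natCast, Int.natAbs_natCast] at this
      have := Nat.div_left_inj (hd _ hl.2) (hd _ hl'.2) |>.1 h
      exact Nat.eq_of_mul_eq_mul_left (Int.natAbs_pos.2 hA) this
  rw [Finset.card_range] at h7
  calc (_ : ℝ) ≤ ((A 0 1).natAbs : ℝ) := by exact_mod_cast h7
    _ = |(A 0 1 : ℝ)| := by rw [Nat.cast_natAbs]; push_cast; rfl

/-- A quantum cat map with an eigenvector in the span of the basis states is given on that span by
a matrix intertwining quantum translations, which can be normalized to be unitary. -/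
theorem IsQuantumCatMap.exists_intertwines {N : ℕ} {A : Matrix.SpecialLinearGroup (Fin 2) ℤ}
    {T : Module.End ℂ (quantumStates N 0)} (hT : IsQuantumCatMap N A T) {μ : ℂ}
    {u : quantumStates N 0} (hu : T.HasEigenvector μ u) {c : Fin N → ℂ}
    (hc : (u : 𝓢'(ℝ, ℂ)) = ofCoords N c) :
    ∃ R : Matrix (Fin N) (Fin N) ℂ,
      Intertwines N A R ∧ R.conjTranspose * R = 1 ∧ R.mulVec c = c := by
  obtain ⟨M, M', hM, hM', hTM⟩ := hT
  have hc0 : c ≠ 0 := by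
    rintro rfl
    exact hu.2 (Subtype.ext (by rw [hc, map_zero]; rfl))
  have hN : N ≠ 0 := by
    obtain ⟨i, -⟩ := Function.ne_iff.1 hc0
    exact i.pos.ne'
  have hMc : M' (ofCoords N c) = ofCoords N (μ • c) := by
    rw [← hc, ← hTM, hu.apply_eq_smul, map_smul, ← hc]
    rfl
  have hμ : μ ≠ 0 := by
    rintro rfl
    rw [zero_smul, map_zero] at hMc
    obtain ⟨ψ, hψ, h⟩ := hM.exists_forall_translation_apply_eq_zero (planck_pos hN) hM' hMc
    exact hc0 (eq_zero_of_forall_translation_apply_eq_zero hψ h)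
  have hE : ∀ (m n : ℤ) (x y : Fin N → ℂ), M' (ofCoords N x) = ofCoords N y →
      M' (ofCoords N ((heisenberg N m n).mulVec x)) =
        ofCoords N ((heisenberg N (A 0 0 * m + A 0 1 * n) (A 1 0 * m + A 1 1 * n)).mulVec y) := by
    intro m n x y hxy
    rw [← translation_ofCoords, hM.translation_apply (planck_pos hN) hM', hxy,
      ← translation_ofCoords]
    congr 2
    simp only [phaseMap, Matrix.SpecialLinearGroup.map_apply_coe, RingHom.mapMatrix_apply,
      Matrix.map_apply, Int.coe_castRingHom]
    push_cast
    ext <;> simp only <;> ring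
  -- The vectors whose image under `M'` stays in the span of the basis states. It contains the
  -- eigenvector and is Heisenberg-invariant by `hE`, so it is everything.
  let p : Submodule ℂ (Fin N → ℂ) :=
    (LinearMap.range (ofCoords N)).comap ((M' : 𝓢'(ℝ, ℂ) →ₗ[ℂ] 𝓢'(ℝ, ℂ)) ∘ₗ ofCoords N)
  have hp : p = ⊤ := by
    refine eq_top_of_heisenberg_invariant (fun m n x hx ↦ ?_) (c := c) ⟨_, hMc.symm⟩ hc0
    obtain ⟨y, hy⟩ := hx
    exact ⟨_, (hE m n x y hy.symm).symm⟩
  have hex : ∀ x : Fin N → ℂ, ∃ y, ofCoords N y = M' (ofCoords N x) := fun x ↦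
    (hp ▸ Submodule.mem_top : x ∈ p)
  choose f hf using hex
  let S' : (Fin N → ℂ) →ₗ[ℂ] (Fin N → ℂ) :=
    { toFun := f
      map_add' := fun x y ↦ ofCoords_injective N (by simp only [map_add, hf])
      map_smul' := fun z x ↦ ofCoords_injective N (by simp only [map_smul, hf, RingHom.id_apply]) }
  have hS' : ∀ x, ofCoords N (S' x) = M' (ofCoords N x) := hf
  have hS : ∀ x, (LinearMap.toMatrix' S').mulVec x = S' x := fun x ↦
    LinearMap.toMatrix'_mulVec S' x
  have hI : Intertwines N A (LinearMap.toMatrix' S') := by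
    intro m n
    apply Matrix.toLin'.injective
    refine LinearMap.ext fun x ↦ ofCoords_injective N ?_
    rw [Matrix.toLin'_apply, Matrix.toLin'_apply, ← Matrix.mulVec_mulVec, ← Matrix.mulVec_mulVec,
      hS, hS, hS', hE m n x _ (hS' x).symm]
  refine hI.exists_unitary hc0 hμ ?_
  rw [hS]
  exact ofCoords_injective N ((hS' c).trans hMc)

/-! ### Averaging over the orbit of a basis state -/

open Matrix in
-- By unitarity the product is the identity, `R ^ (t - s)`, or the adjoint of `R ^ (s - t)`.
theorem norm_conjTranspose_pow_mul_pow_le {N : ℕ} {R : Matrix (Fin N) (Fin N) ℂ}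
    (hR : Rᴴ * R = 1) {i : Fin N} {n : ℕ} {δ : ℝ}
    (hδ : ∀ k, 0 < k → k ≤ n → ‖(R ^ k) i i‖ ≤ δ) {s t : ℕ} (hs : s ≤ n) (ht : t ≤ n) :
    ‖((R ^ s)ᴴ * R ^ t) i i‖ ≤ if s = t then 1 else δ := by
  have hpow : ∀ k, (R ^ k)ᴴ * R ^ k = 1 := fun k ↦ by
    induction k with
    | zero => simp
    | succ k ih =>
      calc (R ^ (k + 1))ᴴ * R ^ (k + 1) = Rᴴ * ((R ^ k)ᴴ * R ^ k) * R := by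
            nth_rw 1 [pow_succ]
            rw [conjTranspose_mul, pow_succ]
            simp only [Matrix.mul_assoc]
        _ = 1 := by rw [ih, Matrix.mul_one, hR]
  split_ifs with h
  · subst h
    rw [hpow]
    simp
  · rcases lt_or_gt_of_ne h with h | h
    · have : (R ^ s)ᴴ * R ^ t = R ^ (t - s) := by
        rw [← Nat.add_sub_cancel' h.le, pow_add, ← Matrix.mul_assoc, hpow, Matrix.one_mul,
          Nat.add_sub_cancel_left]
      rw [this]
      exact hδ _ (by omega) (by omega)
    · have : (R ^ s)ᴴ * R ^ t = (R ^ (s - t))ᴴ := by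
        rw [← Nat.add_sub_cancel' h.le, pow_add, Nat.add_sub_cancel_left]
        rw [conjTranspose_mul, Matrix.mul_assoc, hpow, Matrix.mul_one]
      rw [this, conjTranspose_apply, norm_star]
      exact hδ _ (by omega) (by omega)

open Matrix in
/-- A bound for the entries of a fixed vector of a unitary matrix whose first powers have small
diagonal entries. -/
theorem natCast_mul_norm_sq_le {N : ℕ} {R : Matrix (Fin N) (Fin N) ℂ} (hR : Rᴴ * R = 1)
    {c : Fin N → ℂ} (hc : R *ᵥ c = c) (hc1 : ∑ j, ‖c j‖ ^ 2 = 1) {i : Fin N} {n : ℕ} {δ : ℝ}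
    (hδ0 : 0 ≤ δ) (hδ : ∀ k, 0 < k → k ≤ n → ‖(R ^ k) i i‖ ≤ δ) :
    n * ‖c i‖ ^ 2 ≤ 1 + n * δ := by
  rcases Nat.eq_zero_or_pos n with rfl | hn
  · simp
  have hnR : (0 : ℝ) < n := by exact_mod_cast hn
  have hc' : ∀ t, (R ^ t)ᴴ *ᵥ c = c := by
    have h1 : Rᴴ *ᵥ c = c := by
      nth_rw 1 [← hc]
      rw [mulVec_mulVec, hR, one_mulVec]
    intro t
    induction t with
    | zero => simp
    | succ t ih => rw [pow_succ, conjTranspose_mul, ← mulVec_mulVec, ih, h1]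
  set Q : Matrix (Fin N) (Fin N) ℂ := ∑ t ∈ Finset.range n, R ^ t with hQ
  have hQc : ∑ j, star (Q j i) * c j = n * c i := by
    have h1 : Qᴴ *ᵥ c = (n : ℂ) • c := by
      rw [hQ, conjTranspose_sum, sum_mulVec]
      simp only [hc', Finset.sum_const, Finset.card_range, Nat.cast_smul_eq_nsmul]
    exact congrFun h1 i
  have hQQ : ((∑ j, ‖Q j i‖ ^ 2 : ℝ) : ℂ) = (Qᴴ * Q) i i := by
    rw [mul_apply]
    push_cast
    refine Finset.sum_congr rfl fun j _ ↦ ?_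
    rw [conjTranspose_apply, Complex.star_def, Complex.conj_mul']
  have hQn : ∑ j, ‖Q j i‖ ^ 2 ≤ n + n * n * δ := by
    have h1 : ∑ j, ‖Q j i‖ ^ 2 = ‖(Qᴴ * Q) i i‖ := by
      rw [← hQQ, Complex.norm_real, Real.norm_of_nonneg]
      exact Finset.sum_nonneg fun j _ ↦ by positivity
    rw [h1, hQ, conjTranspose_sum, Finset.sum_mul, Matrix.sum_apply]
    simp only [Finset.mul_sum, Matrix.sum_apply]
    have h2 : ∀ s ∈ Finset.range n, ‖∑ t ∈ Finset.range n, ((R ^ s)ᴴ * R ^ t) i i‖ ≤ 1 + n * δ := by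
      intro s hs
      have hs' := Finset.mem_range.1 hs
      calc _ ≤ ∑ t ∈ Finset.range n, ((if s = t then 1 else 0) + δ) := by
            refine norm_sum_le_of_le _ fun t ht ↦ ?_
            refine (norm_conjTranspose_pow_mul_pow_le hR hδ hs'.le
              (Finset.mem_range.1 ht).le).trans ?_
            split_ifs <;> linarith
        _ = 1 + n * δ := by
            rw [Finset.sum_add_distrib, Finset.sum_ite_eq, if_pos hs]
            simp
    calc _ ≤ ∑ s ∈ Finset.range n, (1 + n * δ) := norm_sum_le_of_le _ h2
      _ = n + n * n * δ := by
        rw [Finset.sum_const, Finset.card_range, nsmul_eq_mul]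
        ring
  have h1 : n * ‖c i‖ ≤ ∑ j, ‖Q j i‖ * ‖c j‖ := by
    calc n * ‖c i‖ = ‖∑ j, star (Q j i) * c j‖ := by rw [hQc, norm_mul, Complex.norm_natCast]
      _ ≤ _ := norm_sum_le_of_le _ fun j _ ↦ by rw [norm_mul, norm_star]
  have h2 : (n * ‖c i‖) ^ 2 ≤ n + n * n * δ := by
    calc (n * ‖c i‖) ^ 2 ≤ (∑ j, ‖Q j i‖ * ‖c j‖) ^ 2 := by gcongr
      _ ≤ (∑ j, ‖Q j i‖ ^ 2) * ∑ j, ‖c j‖ ^ 2 := Finset.sum_mul_sq_le_sq_mul_sq _ _ _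
      _ ≤ _ := by rwa [hc1, mul_one]
  refine le_of_mul_le_mul_left ?_ hnR
  calc n * (n * ‖c i‖ ^ 2) = (n * ‖c i‖) ^ 2 := by ring
    _ ≤ _ := h2
    _ = _ := by ring

/-! ### Powers of a hyperbolic matrix -/

theorem eigenvalue_sq_sub_trace_mul (A : Matrix (Fin 2) (Fin 2) ℤ) (hdet : A.det = 1) {lam : ℝ}
    (hev : Module.End.HasEigenvalue (Matrix.toLin' (A.map (Int.cast : ℤ → ℝ))) lam) :
    lam ^ 2 - A.trace * lam + 1 = 0 := by
  obtain ⟨v, hv, hv0⟩ := hev.exists_hasEigenvector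
  rw [Module.End.mem_eigenspace_iff, Matrix.toLin'_apply] at hv
  have h0 := congrFun hv 0
  have h1 := congrFun hv 1
  simp only [Matrix.mulVec, dotProduct, Fin.sum_univ_two, Matrix.map_apply, Pi.smul_apply,
    smul_eq_mul] at h0 h1
  rw [Matrix.det_fin_two] at hdet
  have hd : (A 0 0 * A 1 1 - A 0 1 * A 1 0 : ℝ) = 1 := by exact_mod_cast hdet
  rw [Matrix.trace_fin_two]
  push_cast
  -- The two identities apply the adjugate of `A - lam` to `(A - lam) v = 0`; some coordinate of `v`
  -- is nonzero.
  have e0 : v 0 * (lam ^ 2 - (A 0 0 + A 1 1) * lam + 1) = 0 := by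
    linear_combination (A 1 1 - lam) * h0 - A 0 1 * h1 - v 0 * hd
  have e1 : v 1 * (lam ^ 2 - (A 0 0 + A 1 1) * lam + 1) = 0 := by
    linear_combination (A 0 0 - lam) * h1 - A 1 0 * h0 - v 1 * hd
  by_contra hne
  apply hv0
  funext j
  fin_cases j
  · exact (mul_eq_zero.1 e0).resolve_right hne
  · exact (mul_eq_zero.1 e1).resolve_right hne

/-- By Cayley–Hamilton both sides satisfy `x_{k+2} = (tr A) x_{k+1} - x_k`, whose characteristic
roots are `lam` and `lam⁻¹`, and they agree for `k = 0, 1`. -/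
theorem pow_zero_one_eq (A : Matrix (Fin 2) (Fin 2) ℤ) (hdet : A.det = 1) {lam : ℝ}
    (hl : lam ≠ 0) (htr : lam ^ 2 - A.trace * lam + 1 = 0) (k : ℕ) :
    ((A ^ k) 0 1 : ℝ) * (lam - lam⁻¹) = A 0 1 * (lam ^ k - lam⁻¹ ^ k) := by
  have hsq : A ^ 2 = A.trace • A - 1 := by
    rw [Matrix.det_fin_two] at hdet
    rw [Matrix.trace_fin_two, sq]
    ext i j
    fin_cases i <;> fin_cases j <;>
      simp [Matrix.mul_apply, Fin.sum_univ_two, -zsmul_eq_mul] <;>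
      first | linear_combination -hdet | ring
  have hinv : lam⁻¹ ^ 2 - A.trace * lam⁻¹ + 1 = 0 := by
    field_simp
    linear_combination htr
  induction k using Nat.twoStepInduction with
  | zero => simp
  | one => simp
  | more k ih0 ih1 =>
    have h1 : (A ^ (k + 2)) 0 1 = A.trace * (A ^ (k + 1)) 0 1 - (A ^ k) 0 1 := by
      rw [pow_add, hsq, mul_sub, mul_one, Matrix.mul_smul, ← pow_succ]
      rfl
    rw [h1]
    push_cast
    linear_combination A.trace * ih1 - ih0 - A 0 1 * lam ^ k * htr + A 0 1 * lam⁻¹ ^ k * hinv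

/-- A triangular integer matrix of determinant one has equal diagonal entries `±1`, hence trace
`±2`. -/
theorem zero_one_ne_zero_of_hyperbolic {A : Matrix (Fin 2) (Fin 2) ℤ} (hdet : A.det = 1)
    (hA : 2 < |A.trace|) : A 0 1 ≠ 0 := by
  intro h
  rw [Matrix.det_fin_two, h, zero_mul, sub_zero] at hdet
  rw [Matrix.trace_fin_two] at hA
  rcases Int.eq_one_or_neg_one_of_mul_eq_one' hdet with ⟨h1, h2⟩ | ⟨h1, h2⟩ <;>
    rw [h1, h2] at hA <;> norm_num at hA

/-- The upper right entry of a power of a hyperbolic matrix does not vanish and is bounded by the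
power of the eigenvalue. -/
theorem exists_pow_zero_one_bound {A : Matrix (Fin 2) (Fin 2) ℤ} (hdet : A.det = 1)
    (hA : 2 < |A.trace|) {lam : ℝ} (hlam : 1 < |lam|)
    (hev : Module.End.HasEigenvalue (Matrix.toLin' (A.map (Int.cast : ℤ → ℝ))) lam) :
    ∃ C : ℝ, 0 < C ∧ ∀ k : ℕ, 0 < k →
      (A ^ k) 0 1 ≠ 0 ∧ |((A ^ k) 0 1 : ℝ)| ≤ C * |lam| ^ k := by
  have hl : lam ≠ 0 := by
    rintro rfl
    simp at hlam
    linarith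
  have hb := zero_one_ne_zero_of_hyperbolic hdet hA
  have hbR : (A 0 1 : ℝ) ≠ 0 := by exact_mod_cast hb
  have htr := eigenvalue_sq_sub_trace_mul A hdet hev
  have hinv : |lam⁻¹| < 1 := by
    rw [abs_inv]
    exact inv_lt_one_of_one_lt₀ hlam
  have hne : ∀ k : ℕ, 0 < k → lam ^ k - lam⁻¹ ^ k ≠ 0 := by
    intro k hk h
    have h1 : |lam| ^ k = |lam⁻¹| ^ k := by rw [← abs_pow, ← abs_pow, sub_eq_zero.1 h]
    have h2 : 1 < |lam| ^ k := one_lt_pow₀ hlam hk.ne'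
    have h3 : |lam⁻¹| ^ k ≤ 1 := pow_le_one₀ (abs_nonneg _) hinv.le
    linarith
  have hd : lam - lam⁻¹ ≠ 0 := by simpa using hne 1 one_pos
  refine ⟨2 * |(A 0 1 : ℝ)| / |lam - lam⁻¹|, by positivity, fun k hk ↦ ?_⟩
  have h := pow_zero_one_eq A hdet hl htr k
  constructor
  · intro h0
    rw [h0, Int.cast_zero, zero_mul] at h
    exact mul_ne_zero hbR (hne k hk) h.symm
  · rw [div_mul_eq_mul_div, le_div_iff₀ (abs_pos.2 hd), ← abs_mul, h, abs_mul]
    have h1 : |lam ^ k - lam⁻¹ ^ k| ≤ 2 * |lam| ^ k := by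
      refine (abs_sub _ _).trans ?_
      rw [abs_pow, abs_pow]
      have h2 : 1 ≤ |lam| ^ k := one_le_pow₀ hlam.le
      have h3 : |lam⁻¹| ^ k ≤ 1 := pow_le_one₀ (abs_nonneg _) hinv.le
      linarith
    calc _ ≤ |(A 0 1 : ℝ)| * (2 * |lam| ^ k) := by gcongr
      _ = _ := by ring

/-! ### The choice of the averaging time -/

theorem eventually_log_mul_rpow_le {L K ε : ℝ} (hε : 0 < ε) :
    ∀ᶠ x : ℝ in Filter.atTop, (Real.logb L x + 1) * (K * x ^ (-(ε / 4))) ≤ ε / 2 := by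
  have h1 : Filter.Tendsto (fun x : ℝ ↦ Real.log x * x ^ (-(ε / 4))) Filter.atTop (nhds 0) := by
    have := (isLittleO_log_rpow_atTop (show 0 < ε / 4 by positivity)).tendsto_div_nhds_zero
    refine this.congr' ?_
    filter_upwards [Filter.eventually_gt_atTop 0] with x hx
    rw [Real.rpow_neg hx.le, div_eq_mul_inv]
  have h2 := tendsto_rpow_neg_atTop (show 0 < ε / 4 by positivity)
  have h3 : Filter.Tendsto (fun x : ℝ ↦ (Real.logb L x + 1) * (K * x ^ (-(ε / 4))))
      Filter.atTop (nhds 0) := by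
    have := (h1.const_mul (K / Real.log L)).add (h2.const_mul K)
    simp only [mul_zero, add_zero] at this
    refine this.congr fun x ↦ ?_
    rw [Real.logb]
    ring
  exact h3.eventually_le_const (by positivity)

/-- Rounding up costs one factor `L`: `L ^ n ≤ L x^{1-ε/2}`, so the square root is at most `√(C L)
x^{-ε/4}`, while `n ≤ log_L x + 1`. This is where the exponent `ε/4` comes from. -/
theorem ceil_mul_sqrt_le {L C ε x : ℝ} (hL : 1 < L) (hC : 0 < C) (hε : 0 < ε) (hε1 : ε < 1)
    (hx : 1 < x)
    (h : (Real.logb L x + 1) * (Real.sqrt (C * L) * x ^ (-(ε / 4))) ≤ ε / 2) :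
    ⌈(1 - ε / 2) * Real.logb L x⌉₊ *
      Real.sqrt (C * L ^ ⌈(1 - ε / 2) * Real.logb L x⌉₊ / x) ≤ ε / 2 := by
  have hx0 : 0 < x := by linarith
  have hL0 : 0 < L := by linarith
  have hl : 0 < Real.logb L x := Real.logb_pos hL hx
  set n := ⌈(1 - ε / 2) * Real.logb L x⌉₊ with hn
  have hn1 : (n : ℝ) < (1 - ε / 2) * Real.logb L x + 1 :=
    Nat.ceil_lt_add_one (mul_nonneg (by linarith) hl.le)
  have hn2 : (n : ℝ) ≤ Real.logb L x + 1 := by nlinarith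
  have hLn : L ^ n ≤ x ^ (1 - ε / 2) * L := by
    rw [← Real.rpow_natCast]
    calc L ^ (n : ℝ) ≤ L ^ ((1 - ε / 2) * Real.logb L x + 1) :=
          Real.rpow_le_rpow_of_exponent_le hL.le hn1.le
      _ = x ^ (1 - ε / 2) * L := by
          rw [Real.rpow_add hL0, Real.rpow_one, mul_comm (1 - ε / 2), Real.rpow_mul hL0.le,
            Real.rpow_logb hL0 hL.ne' hx0]
  have hs : Real.sqrt (C * L ^ n / x) ≤ Real.sqrt (C * L) * x ^ (-(ε / 4)) := by
    rw [Real.sqrt_le_left (by positivity), mul_pow, Real.sq_sqrt (by positivity),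
      ← Real.rpow_natCast (x ^ _), ← Real.rpow_mul hx0.le, div_le_iff₀ hx0]
    calc C * L ^ n ≤ C * (x ^ (1 - ε / 2) * L) := by gcongr
      _ = C * L * x ^ (-(ε / 4) * (2 : ℕ) + 1) := by
          rw [mul_comm (x ^ _), ← mul_assoc]
          congr 2
          push_cast
          ring
      _ = C * L * x ^ (-(ε / 4) * (2 : ℕ)) * x := by
          rw [Real.rpow_add hx0, Real.rpow_one]
          ring
  exact (mul_le_mul hn2 hs (Real.sqrt_nonneg _) (by linarith)).trans h

end

end QuantumCat

theorem theorem2 (A : Matrix.SpecialLinearGroup (Fin 2) ℤ)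
    (hA : 2 < |(A : Matrix (Fin 2) (Fin 2) ℤ).trace|)
    (hab : Even (A 0 0 * A 0 1)) (hcd : Even (A 1 0 * A 1 1))
    (lam : ℝ) (hlam : 1 < |lam|)
    (hev : Module.End.HasEigenvalue
      (Matrix.toLin' ((A : Matrix (Fin 2) (Fin 2) ℤ).map (Int.cast : ℤ → ℝ))) lam)
    (ε : ℝ) (hε : 0 < ε) (hε1 : ε < 1) :
    ∃ N₀ : ℕ, ∀ N : ℕ, N₀ ≤ N → Odd N →
      ∀ M : Module.End ℂ (QuantumCat.quantumStates N 0), QuantumCat.IsQuantumCatMap N A M →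
        ∀ (μ : ℂ) (u : QuantumCat.quantumStates N 0), M.HasEigenvector μ u →
          QuantumCat.l2Norm N u = 1 →
            QuantumCat.lInfNorm N u ≤ 1 / Real.sqrt ((1 - ε) * Real.logb |lam| N) := by
  obtain ⟨C, hC, hb⟩ := QuantumCat.exists_pow_zero_one_bound A.det_coe hA hlam hev
  have hev1 := tendsto_natCast_atTop_atTop.eventually
    ((QuantumCat.eventually_log_mul_rpow_le (L := |lam|) (K := Real.sqrt (C * |lam|)) hε).and
      (Filter.eventually_gt_atTop (1 : ℝ)))
  obtain ⟨N₀, hN₀⟩ := Filter.eventually_atTop.1 hev1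
  refine ⟨N₀, fun N hN _ M hM μ u hu hu1 ↦ ?_⟩
  obtain ⟨hlog, hN1⟩ := hN₀ N hN
  have hl : 0 < Real.logb |lam| N := Real.logb_pos hlam hN1
  have hN0 : (0 : ℝ) < N := by linarith
  have : Nonempty (Fin N) := ⟨⟨0, by exact_mod_cast hN0⟩⟩
  have hsum : ∑ j, ‖QuantumCat.coords N u j‖ ^ 2 = 1 := by
    rwa [QuantumCat.l2Norm, Real.sqrt_eq_one] at hu1
  have hu2 : (u : TemperedDistribution ℝ ℂ) = QuantumCat.ofCoords N (QuantumCat.coords N u) := by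
    rw [QuantumCat.ofCoords_apply]
    -- If `u` were outside the span, its coordinates would be the default value zero, contradicting
    -- the unit norm.
    by_cases h : ∃ c : Fin N → ℂ, (u : TemperedDistribution ℝ ℂ) =
        ∑ j, c j • QuantumCat.basisState N j
    · obtain ⟨c, hc⟩ := h
      rw [QuantumCat.coords_eq N u c hc]
      exact hc
    · rw [QuantumCat.coords, dif_neg h] at hsum
      simp at hsum
  obtain ⟨R, hRA, hR1, hRc⟩ := hM.exists_intertwines hu hu2
  refine ciSup_le fun i ↦ ?_
  set n := ⌈(1 - ε / 2) * Real.logb |lam| N⌉₊ with hn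
  have hδ : ∀ k, 0 < k → k ≤ n → ‖(R ^ k) i i‖ ≤ Real.sqrt (C * |lam| ^ n / N) := by
    intro k hk hkn
    have hRk : (R ^ k).conjTranspose * R ^ k = 1 :=
      Unitary.star_mul_self_of_mem (pow_mem (Matrix.mem_unitaryGroup_iff'.2 hR1) k)
    refine Real.le_sqrt_of_sq_le (((hRA.pow k).norm_diag_sq_le hRk (hb k hk).1 i).trans ?_)
    gcongr
    refine (hb k hk).2.trans ?_
    gcongr
    exact hlam.le
  have h1 := QuantumCat.natCast_mul_norm_sq_le hR1 hRc hsum (Real.sqrt_nonneg _) hδ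
  have h2 := QuantumCat.ceil_mul_sqrt_le hlam hC hε hε1 hN1 hlog
  have h3 : (1 - ε / 2) * Real.logb |lam| N ≤ n := Nat.le_ceil _
  rw [one_div, ← Real.sqrt_inv, ← one_div]
  refine Real.le_sqrt_of_sq_le ?_
  have h4 : 0 < (1 - ε) * Real.logb |lam| N := mul_pos (by linarith) hl
  rw [le_div_iff₀ h4]
  set q := ‖QuantumCat.coords N u i‖ ^ 2 with hq
  have hq0 : 0 ≤ q := by positivity
  have h5 : (1 - ε / 2) * Real.logb |lam| N * q ≤ 1 + ε / 2 := by
    have := mul_le_mul_of_nonneg_right h3 hq0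
    linarith
  -- Half of `ε` was spent on the averaging time and half on the error `n δ`; what remains is `(1 +
  -- ε/2)(1 - ε) ≤ 1 - ε/2`.
  have h6 : (1 - ε / 2) * (q * ((1 - ε) * Real.logb |lam| N)) ≤ (1 - ε / 2) * 1 := by
    have := mul_le_mul_of_nonneg_right h5 (show 0 ≤ 1 - ε by linarith)
    nlinarith
  exact le_of_mul_le_mul_left h6 (by linarith)
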